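/- For a nonnegative integer $n$ let $v_0(n)$ denote the coefficient of $q^n$ in $$\sum_{m=0}^{\infty}\frac{q^{m^2}(-q;q^2)_m}{(q;q^2)_m},\qquad (a;q)_0=1,\quad (a;q)_m=\prod_{i=1}^{m}(1-aq^{i-1}).$$ (This series equals $(V_0(q)+1)/2$, where $V_0(q)$ is the eighth order mock theta function of Gordon and McIntosh.) Theorem. Let $p\ge 3$ be a prime and let $n,\alpha\ge 0$ be integers. Then: 1. if $n$ is not a triangular number, that is, $n\ne k(k+1)/2$ for every integer $k\ge 0$, then $$v_0\bigl(p^{2\alpha}\,9^2\,(32n+4)\bigr)\equiv 0\pmod{27};$$ 2. for every $i\in\{1,2,\dots,p-1\}$, $$v_0\bigl(p^{2\alpha+1}\,9^2\,(32pn+32i+4p)\bigr)\equiv 0\pmod{27};$$ 3. for every integer $j\ge 0$ such that $8j+1$ is a quadratic nonresidue modulo $p$, $$v_0\bigl(p^{2\alpha}\,9^2\,(32pn+32j+4)\bigr)\equiv 0\pmod{27}.$$ -/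

import Mathlib

open PowerSeries in
/-- The finite `q`-shifted factorial `(a; q)_n = ∏_{i=1}^{n} (1 - a q^{i-1})`. -/
def qPoch {R : Type*} [CommRing R] (a q : R) (n : ℕ) : R :=
  ∏ i ∈ Finset.range n, (1 - a * q ^ i)

open PowerSeries in
/-- The `m`-th summand `q^{m²} (-q; q²)_m / (q; q²)_m`, as a formal power series in `q = X` with
integer coefficients. The denominator has constant coefficient `1`, so `invOfUnit _ 1` is its
inverse, see `qPoch_mul_invOfUnit`. -/
noncomputable def v0Term (m : ℕ) : PowerSeries ℤ :=
  (X : PowerSeries ℤ) ^ (m ^ 2) * qPoch (-X : PowerSeries ℤ) (X ^ 2) m *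
    invOfUnit (qPoch (X : PowerSeries ℤ) (X ^ 2) m) 1

open PowerSeries in
theorem qPoch_mul_invOfUnit (m : ℕ) :
    qPoch (X : PowerSeries ℤ) (X ^ 2) m * invOfUnit (qPoch (X : PowerSeries ℤ) (X ^ 2) m) 1 = 1 := by
  apply mul_invOfUnit
  simp [qPoch, map_prod]

open PowerSeries in
/-- Only the summands with `m ≤ n` contribute to the coefficient of `q ^ n`. -/
theorem coeff_v0Term_of_lt {n m : ℕ} (h : n < m) : coeff n (v0Term m) = 0 := by
  rw [v0Term, mul_assoc, coeff_X_pow_mul', if_neg]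
  nlinarith

open PowerSeries in
/-- `v₀(n)`: the coefficient of `q ^ n` in `∑_{m ≥ 0} q^{m²} (-q; q²)_m / (q; q²)_m`. The sum over
`m` is cut at `m = n`, which loses nothing by `coeff_v0Term_of_lt`. -/
noncomputable def v0 (n : ℕ) : ℤ :=
  ∑ m ∈ Finset.range (n + 1), coeff n (v0Term m)

open PowerSeries PowerSeries.WithPiTopology in
/-- The generating function of `v₀` is the sum of the series of the `v0Term m`, coefficientwise. -/
theorem hasSum_v0Term : HasSum v0Term (PowerSeries.mk v0) := by
  rw [hasSum_iff_hasSum_coeff]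
  intro n
  rw [coeff_mk]
  refine hasSum_sum_of_ne_finset_zero fun m hm => coeff_v0Term_of_lt ?_
  rw [Finset.mem_range] at hm
  omega

/-! Write φ(q) = ∑ q^(n²) over n ∈ ℤ, ψ(q) = ∑ q^(n(n+1)/2) over n ≥ 0, and D(q) = ∏ (1 + q^k). The
even part of the generating function of v₀ comes from a bilateral series W(γ) at γ = 1. A
telescoping relation links W(γ) to W(q²γ) (`wellPoisedSum_contiguous`); iterating it down to W(0) =
φ(q²) gives W(1) = φ(q²)² / φ(-q⁴).

Sections of this quotient, using 2-dissections of φ and the product formulas supplied by Jacobi's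
triple product, give ∑ 2 v₀(32n+4) q^n = 6ψ(q) + 1024 q D(q)^27 φ(-q) (`vThirtyTwo_eq`).

Modulo 27 the factor D(q)^27 may be replaced by D(q³)^9. The 3-dissections of φ(-q) and ψ(q) share
their two components up to the factor D(q³), which makes D³ = ψ / φ(-q) computable modulo 27. Taking
the coefficients of index 9j+1 turns q D^27 φ(-q) into ψ(q) + 9q ψ(q⁹) modulo 27
(`sec_sec_vPart_congr`). Both series live on exponents n with 8n+1 a square. Hence 27 divides
v₀(36(8j+1)) unless 8j+1 is a square (`v0_congr_of_not_isSquare`), and each of the three families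
consists of arguments 36·M with M ≡ 1 mod 8 not a square. -/

namespace QSeries

open PowerSeries Finset

/-! ### Formal infinite sums and products, controlled modulo powers of `X`. -/

/-- Two power series that agree modulo every power of `X` are equal. -/
theorem eq_of_forall_X_pow_dvd {f g : PowerSeries ℤ} (h : ∀ N, (X : PowerSeries ℤ) ^ N ∣ f - g) :
    f = g := by
  ext n
  have := X_pow_dvd_iff.1 (h (n + 1)) n (Nat.lt_succ_self n)
  rw [map_sub] at this
  exact sub_eq_zero.1 this

theorem X_pow_dvd_of_mul_left {u f : PowerSeries ℤ} (hu : constantCoeff u = 1) {N : ℕ}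
    (h : (X : PowerSeries ℤ) ^ N ∣ u * f) : (X : PowerSeries ℤ) ^ N ∣ f := by
  have h1 : invOfUnit u 1 * u = 1 := invOfUnit_mul u 1 (by simpa using hu)
  have h2 := h.mul_left (invOfUnit u 1)
  rwa [← mul_assoc, h1, one_mul] at h2

/-- The sum of a sequence of power series whose `n`-th term is divisible by `X ^ n`. -/
noncomputable def infsum (f : ℕ → PowerSeries ℤ) : PowerSeries ℤ :=
  mk fun d => coeff d (∑ n ∈ range (d + 1), f n)

/-- The product of a sequence of power series whose `k`-th term is `1` modulo `X ^ (k + 1)`. -/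
noncomputable def infprod (f : ℕ → PowerSeries ℤ) : PowerSeries ℤ :=
  mk fun d => coeff d (∏ n ∈ range d, f n)

theorem X_pow_dvd_sum_sub {f : ℕ → PowerSeries ℤ} (hf : ∀ n, (X : PowerSeries ℤ) ^ n ∣ f n)
    {M N : ℕ} (h : M ≤ N) :
    (X : PowerSeries ℤ) ^ M ∣ ∑ n ∈ range N, f n - ∑ n ∈ range M, f n := by
  rw [← sum_Ico_eq_sub _ h]
  exact dvd_sum fun n hn => (pow_dvd_pow _ (mem_Ico.1 hn).1).trans (hf n)

theorem X_pow_dvd_prod_sub {f : ℕ → PowerSeries ℤ}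
    (hf : ∀ k, (X : PowerSeries ℤ) ^ (k + 1) ∣ f k - 1) {M N : ℕ} (h : M ≤ N) :
    (X : PowerSeries ℤ) ^ (M + 1) ∣ ∏ n ∈ range N, f n - ∏ n ∈ range M, f n := by
  induction N, h using Nat.le_induction with
  | base => simp
  | succ N hN ih =>
    have h1 := ((pow_dvd_pow X (by omega : M + 1 ≤ N + 1)).trans (hf N)).mul_left
      (∏ n ∈ range N, f n)
    rw [prod_range_succ]
    convert dvd_add h1 ih using 1
    ring

theorem X_pow_dvd_infsum_sub {f : ℕ → PowerSeries ℤ} (hf : ∀ n, (X : PowerSeries ℤ) ^ n ∣ f n)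
    (N : ℕ) : (X : PowerSeries ℤ) ^ N ∣ infsum f - ∑ n ∈ range N, f n := by
  refine X_pow_dvd_iff.2 fun d hd => ?_
  have := X_pow_dvd_iff.1 (X_pow_dvd_sum_sub hf (Nat.succ_le_of_lt hd)) d (Nat.lt_succ_self d)
  rw [map_sub] at this ⊢
  rw [infsum, coeff_mk]
  linarith

theorem X_pow_dvd_infprod_sub {f : ℕ → PowerSeries ℤ}
    (hf : ∀ k, (X : PowerSeries ℤ) ^ (k + 1) ∣ f k - 1) {M N : ℕ} (h : M ≤ N) :
    (X : PowerSeries ℤ) ^ (M + 1) ∣ infprod f - ∏ n ∈ range N, f n := by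
  refine X_pow_dvd_iff.2 fun d hd => ?_
  have := X_pow_dvd_iff.1 (X_pow_dvd_prod_sub hf (by omega : d ≤ N)) d (Nat.lt_succ_self d)
  rw [map_sub] at this ⊢
  rw [infprod, coeff_mk]
  linarith

theorem eq_infsum {f : ℕ → PowerSeries ℤ} (hf : ∀ n, (X : PowerSeries ℤ) ^ n ∣ f n)
    {g : PowerSeries ℤ} (h : ∀ N, (X : PowerSeries ℤ) ^ N ∣ g - ∑ n ∈ range N, f n) :
    g = infsum f := by
  refine eq_of_forall_X_pow_dvd fun N => ?_
  convert dvd_sub (h N) (X_pow_dvd_infsum_sub hf N) using 1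
  ring

theorem eq_infprod {f : ℕ → PowerSeries ℤ} (hf : ∀ k, (X : PowerSeries ℤ) ^ (k + 1) ∣ f k - 1)
    {g : PowerSeries ℤ} (h : ∀ N, ∃ M, N ≤ M ∧ (X : PowerSeries ℤ) ^ N ∣ g - ∏ n ∈ range M, f n) :
    g = infprod f := by
  refine eq_of_forall_X_pow_dvd fun N => ?_
  obtain ⟨M, hM, h1⟩ := h N
  have h2 := (pow_dvd_pow X (Nat.le_succ N)).trans (X_pow_dvd_infprod_sub hf hM)
  convert dvd_sub h1 h2 using 1
  ring

theorem constantCoeff_infprod (f : ℕ → PowerSeries ℤ) : constantCoeff (infprod f) = 1 := by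
  rw [← coeff_zero_eq_constantCoeff_apply, infprod, coeff_mk]
  simp

theorem X_pow_dvd_mul_sub_mul {a b c d : PowerSeries ℤ} {N : ℕ}
    (h1 : (X : PowerSeries ℤ) ^ N ∣ a - b) (h2 : (X : PowerSeries ℤ) ^ N ∣ c - d) :
    (X : PowerSeries ℤ) ^ N ∣ a * c - b * d := by
  convert dvd_add (h1.mul_right c) (h2.mul_left b) using 1
  ring

theorem X_pow_dvd_mul_sub_one {a c : PowerSeries ℤ} {N : ℕ}
    (h1 : (X : PowerSeries ℤ) ^ N ∣ a - 1) (h2 : (X : PowerSeries ℤ) ^ N ∣ c - 1) :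
    (X : PowerSeries ℤ) ^ N ∣ a * c - 1 := by
  simpa using X_pow_dvd_mul_sub_mul h1 h2

theorem infprod_mul {f g : ℕ → PowerSeries ℤ}
    (hf : ∀ k, (X : PowerSeries ℤ) ^ (k + 1) ∣ f k - 1)
    (hg : ∀ k, (X : PowerSeries ℤ) ^ (k + 1) ∣ g k - 1) :
    infprod f * infprod g = infprod fun k => f k * g k := by
  refine eq_infprod (fun k => X_pow_dvd_mul_sub_one (hf k) (hg k)) fun N => ⟨N, le_rfl, ?_⟩
  rw [prod_mul_distrib]
  have h := pow_dvd_pow (X : PowerSeries ℤ) (Nat.le_succ N)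
  exact X_pow_dvd_mul_sub_mul (h.trans (X_pow_dvd_infprod_sub hf le_rfl))
    (h.trans (X_pow_dvd_infprod_sub hg le_rfl))

/-- Grouping the factors of an infinite product in blocks of length `m`. -/
theorem infprod_block {f : ℕ → PowerSeries ℤ} (hf : ∀ k, (X : PowerSeries ℤ) ^ (k + 1) ∣ f k - 1)
    {m : ℕ} (hm : 0 < m) : infprod f = infprod fun k => ∏ r ∈ range m, f (m * k + r) := by
  have hg : ∀ k, (X : PowerSeries ℤ) ^ (k + 1) ∣ ∏ r ∈ range m, f (m * k + r) - 1 := by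
    intro k
    refine Finset.prod_induction _ (fun a => (X : PowerSeries ℤ) ^ (k + 1) ∣ a - 1)
      (fun a b => X_pow_dvd_mul_sub_one) (by simp) fun r _ => ?_
    exact (pow_dvd_pow X (by nlinarith)).trans (hf _)
  refine eq_infprod hg fun N => ⟨N, le_rfl, ?_⟩
  have h : ∏ k ∈ range N, ∏ r ∈ range m, f (m * k + r) = ∏ n ∈ range (m * N), f n := by
    clear hg
    induction N with
    | zero => simp
    | succ N ih => rw [prod_range_succ, ih, Nat.mul_succ, prod_range_add]
  rw [h]
  exact (pow_dvd_pow (X : PowerSeries ℤ) (Nat.le_succ N)).trans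
    (X_pow_dvd_infprod_sub hf (by nlinarith))

/-! ### Gaussian binomials and the finite q-binomial theorem. -/

/-- The Gaussian binomial coefficient with parameter `Q`. -/
def gaussBinom {R : Type*} [CommRing R] (Q : R) : ℕ → ℕ → R
  | _, 0 => 1
  | 0, _ + 1 => 0
  | m + 1, k + 1 => gaussBinom Q m k + Q ^ (k + 1) * gaussBinom Q m (k + 1)

section gaussBinom
variable {R : Type*} [CommRing R] (Q : R)

@[simp] theorem gaussBinom_zero_right (m : ℕ) : gaussBinom Q m 0 = 1 := by
  cases m <;> rfl

theorem gaussBinom_succ_succ (m k : ℕ) :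
    gaussBinom Q (m + 1) (k + 1) = gaussBinom Q m k + Q ^ (k + 1) * gaussBinom Q m (k + 1) := rfl

theorem gaussBinom_eq_zero {m k : ℕ} (h : m < k) : gaussBinom Q m k = 0 := by
  induction m generalizing k with
  | zero => cases k with
    | zero => omega
    | succ k => rfl
  | succ m ih => cases k with
    | zero => omega
    | succ k => rw [gaussBinom_succ_succ, ih (by omega), ih (by omega), mul_zero, add_zero]

theorem choose_succ_two (n : ℕ) : (n + 1).choose 2 = n.choose 2 + n := by
  rw [Nat.choose_succ_succ' n 1, Nat.choose_one_right, add_comm]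

/-- The homogeneous `q`-binomial theorem. -/
theorem prod_add_mul_pow (m : ℕ) (a b : R) :
    ∏ i ∈ range m, (a + b * Q ^ i) =
      ∑ k ∈ range (m + 1), Q ^ k.choose 2 * gaussBinom Q m k * a ^ (m - k) * b ^ k := by
  induction m generalizing b with
  | zero => simp
  | succ m ih =>
    have h1 : ∏ i ∈ range m, (a + b * Q ^ (i + 1)) = ∏ i ∈ range m, (a + b * Q * Q ^ i) :=
      prod_congr rfl fun i _ => by ring
    rw [prod_range_succ', h1, ih, pow_zero, mul_one, mul_add,
      sum_range_succ' _ (m + 1)]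
    have h2 : (∑ k ∈ range (m + 1),
        Q ^ k.choose 2 * gaussBinom Q m k * a ^ (m - k) * (b * Q) ^ k) * a =
        ∑ k ∈ range (m + 1), Q ^ (k + 1).choose 2 * (Q ^ (k + 1) * gaussBinom Q m (k + 1)) *
          a ^ (m - k) * b ^ (k + 1) + a ^ (m + 1) := by
      rw [sum_mul, sum_range_succ', sum_range_succ, gaussBinom_eq_zero Q (Nat.lt_succ_self m)]
      simp only [mul_zero, zero_mul, add_zero, Nat.choose_zero_succ, pow_zero,
        gaussBinom_zero_right, Nat.sub_zero, mul_one, one_mul, pow_succ a m, add_left_inj]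
      refine sum_congr rfl fun k hk => ?_
      have : m - k = m - (k + 1) + 1 := by have := mem_range.1 hk; omega
      rw [this]
      ring
    rw [h2]
    simp only [gaussBinom_succ_succ, mul_add, add_mul, sum_add_distrib, Nat.add_sub_add_right,
      gaussBinom_zero_right, Nat.choose_zero_succ, pow_zero, Nat.sub_zero, mul_one, one_mul]
    rw [sum_mul]
    have h3 : ∀ k, Q ^ k.choose 2 * gaussBinom Q m k * a ^ (m - k) * (b * Q) ^ k * b =
        Q ^ (k + 1).choose 2 * gaussBinom Q m k * a ^ (m - k) * b ^ (k + 1) := fun k => by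
      rw [choose_succ_two]; ring
    simp only [h3]
    ring

/-- The quotient formula for Gaussian binomials with denominators cleared. The Pascal recurrence
combines the cases (k, j+1) and (k+1, j), hence the nested induction. -/
theorem gaussBinom_mul_prod_mul_prod (k j : ℕ) :
    gaussBinom Q (k + j) k * (∏ i ∈ range k, (1 - Q ^ (i + 1))) *
      (∏ i ∈ range j, (1 - Q ^ (i + 1))) = ∏ i ∈ range (k + j), (1 - Q ^ (i + 1)) := by
  induction k generalizing j with
  | zero => simp
  | succ k ihk =>
    induction j with
    | zero =>
      have := ihk 0
      simp only [add_zero, range_zero, prod_empty, mul_one] at this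
      rw [add_zero, gaussBinom_succ_succ, gaussBinom_eq_zero Q (Nat.lt_succ_self k),
        prod_range_succ, range_zero, prod_empty]
      linear_combination (1 - Q ^ (k + 1)) * this
    | succ j ihj =>
      have e : k + 1 + (j + 1) = (k + (j + 1)) + 1 := by ring
      have e' : k + (j + 1) = k + 1 + j := by ring
      have h1 := ihk (j + 1)
      have h2 := ihj
      rw [e, gaussBinom_succ_succ, prod_range_succ _ (k + (j + 1))]
      rw [← e'] at h2
      rw [prod_range_succ _ k, prod_range_succ _ j] at *
      linear_combination (1 - Q ^ (k + 1)) * h1 + Q ^ (k + 1) * (1 - Q ^ (j + 1)) * h2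

end gaussBinom

/-! ### Jacobi's triple product. -/

theorem sum_range_two_mul_succ {R : Type*} [AddCommMonoid R] (h : ℕ → R) (N : ℕ) :
    ∑ k ∈ range (2 * N + 1), h k =
      h N + ∑ n ∈ range N, (h (N + (n + 1)) + h (N - (n + 1))) := by
  rw [two_mul, add_assoc, sum_range_add, sum_add_distrib, sum_range_succ' (fun k => h (N + k)),
    ← sum_range_reflect]
  have : ∀ j ∈ range N, h (N - 1 - j) = h (N - (j + 1)) := fun j _ => by congr 1; omega
  rw [sum_congr rfl this, add_zero]
  abel

theorem choose_two_add (a b : ℕ) : (a + b).choose 2 = a.choose 2 + b.choose 2 + a * b := by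
  induction b with
  | zero => simp
  | succ b ih => rw [← add_assoc, choose_succ_two, choose_succ_two, ih]; ring

theorem two_mul_choose_two (n : ℕ) : 2 * n.choose 2 + n = n ^ 2 := by
  induction n with
  | zero => simp
  | succ n ih => rw [choose_succ_two]; linarith [ih, (by ring : (n + 1) ^ 2 = n ^ 2 + 2 * n + 1)]

/-- The pair of terms with index `n` and `-n` of Ramanujan's theta function `f(x, y)`. -/
def thetaTerm {R : Type*} [CommRing R] (x y : R) : ℕ → R
  | 0 => 1
  | n + 1 => x ^ (n + 2).choose 2 * y ^ (n + 1).choose 2 +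
      x ^ (n + 1).choose 2 * y ^ (n + 2).choose 2

/-- The finite form of Jacobi's triple product identity. -/
theorem finite_triple_product {R : Type*} [CommRing R] [IsDomain R] {x y : R} (hx : x ≠ 0)
    (hy : y ≠ 0) (N : ℕ) :
    ∏ i ∈ range N, ((1 + x * (x * y) ^ i) * (1 + y * (x * y) ^ i)) =
      gaussBinom (x * y) (2 * N) N + ∑ n ∈ range N,
        (gaussBinom (x * y) (2 * N) (N + (n + 1)) *
            (x ^ (n + 2).choose 2 * y ^ (n + 1).choose 2) +
          gaussBinom (x * y) (2 * N) (N - (n + 1)) *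
            (x ^ (n + 1).choose 2 * y ^ (n + 2).choose 2)) := by
  set Q := x * y with hQ
  have hQ0 : Q ≠ 0 := mul_ne_zero hx hy
  -- The q-binomial theorem is applied with a = Q^N and b = x. Since Q = xy, each factor with i < N
  -- equals x Q^i (1 + y Q^(N-1-i)), so the lower half of the product yields the factors in y.
  have h1 : ∏ i ∈ range (2 * N), (Q ^ N + x * Q ^ i) = x ^ N * Q ^ (N.choose 2 + N ^ 2) *
      ∏ i ∈ range N, ((1 + x * Q ^ i) * (1 + y * Q ^ i)) := by
    rw [two_mul, prod_range_add, prod_mul_distrib]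
    have ha : ∏ i ∈ range N, (Q ^ N + x * Q ^ (N + i)) =
        Q ^ (N ^ 2) * ∏ i ∈ range N, (1 + x * Q ^ i) := by
      have hc : Q ^ N ^ 2 = ∏ i ∈ range N, Q ^ N := by simp [sq, pow_mul]
      rw [hc, ← prod_mul_distrib]
      exact prod_congr rfl fun i _ => by ring
    have hb : ∏ i ∈ range N, (Q ^ N + x * Q ^ i) =
        x ^ N * Q ^ N.choose 2 * ∏ i ∈ range N, (1 + y * Q ^ i) := by
      rw [← prod_range_reflect (fun i => 1 + y * Q ^ i)]
      have hc : Q ^ N.choose 2 = ∏ i ∈ range N, Q ^ i := by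
        rw [prod_pow_eq_pow_sum, sum_range_id, Nat.choose_two_right]
      rw [hc]
      have hd : x ^ N = ∏ i ∈ range N, x := by simp
      rw [hd, ← prod_mul_distrib, ← prod_mul_distrib]
      refine prod_congr rfl fun i hi => ?_
      have hi := mem_range.1 hi
      obtain ⟨j, rfl⟩ : ∃ j, N = i + j + 1 := ⟨N - 1 - i, by omega⟩
      rw [show i + j + 1 - 1 - i = j by omega, hQ]
      ring
    rw [ha, hb]
    ring
  have h0 : x ^ N * Q ^ (N.choose 2 + N ^ 2) ≠ 0 :=
    mul_ne_zero (pow_ne_zero _ hx) (pow_ne_zero _ hQ0)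
  refine mul_left_cancel₀ h0 ?_
  rw [← h1, prod_add_mul_pow, sum_range_two_mul_succ, mul_add, mul_sum]
  congr 1
  · rw [show 2 * N - N = N by omega]
    ring
  · refine sum_congr rfl fun n hn => ?_
    have hn := mem_range.1 hn
    obtain ⟨j, rfl⟩ : ∃ j, N = j + (n + 1) := ⟨N - (n + 1), by omega⟩
    rw [show 2 * (j + (n + 1)) - (j + (n + 1) + (n + 1)) = j by omega,
      show 2 * (j + (n + 1)) - (j + (n + 1) - (n + 1)) = j + 2 * (n + 1) by omega,
      show j + (n + 1) - (n + 1) = j by omega, choose_two_add (j + (n + 1)),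
      choose_two_add j, choose_succ_two (n + 1)]
    have h2 := two_mul_choose_two (n + 1)
    set c := (n + 1).choose 2
    set m := n + 1
    rw [mul_add (x ^ (j + m) * _)]
    congr 1
    · rw [hQ]; ring
    · have : ((x * y) ^ (j + m)) ^ (j + 2 * m) =
          (x * y) ^ ((j + m) ^ 2 + j * m + (2 * c + m)) := by rw [h2]; ring
      rw [hQ, this]; ring

theorem le_choose_succ_two (n : ℕ) : n ≤ (n + 1).choose 2 := by
  rw [choose_succ_two]; omega

theorem X_pow_dvd_thetaTerm {x y : PowerSeries ℤ} (hx : X ∣ x) (hy : X ∣ y) (n : ℕ) :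
    (X : PowerSeries ℤ) ^ n ∣ thetaTerm x y n := by
  cases n with
  | zero => simp
  | succ n =>
    have h := le_choose_succ_two (n + 1)
    exact dvd_add ((((pow_dvd_pow X h).trans (pow_dvd_pow_of_dvd hx _))).mul_right _)
      ((((pow_dvd_pow X h).trans (pow_dvd_pow_of_dvd hy _))).mul_left _)

/-- Ramanujan's theta function `f(x, y) = ∑ x ^ (n (n + 1) / 2) y ^ (n (n - 1) / 2)`. -/
noncomputable def theta (x y : PowerSeries ℤ) : PowerSeries ℤ := infsum (thetaTerm x y)

theorem X_pow_dvd_one_add_mul_pow_sub_one {x y : PowerSeries ℤ} (hx : X ∣ x) (hy : X ∣ y) (k : ℕ) :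
    (X : PowerSeries ℤ) ^ (k + 1) ∣ (1 + x * y ^ k) - 1 := by
  rw [add_sub_cancel_left, pow_succ']
  exact mul_dvd_mul hx (pow_dvd_pow_of_dvd hy k)

theorem X_pow_dvd_one_sub_pow_sub_one {x : PowerSeries ℤ} (hx : X ∣ x) (k : ℕ) :
    (X : PowerSeries ℤ) ^ (k + 1) ∣ (1 - x ^ (k + 1)) - 1 := by
  rw [sub_sub_cancel_left, dvd_neg]
  exact pow_dvd_pow_of_dvd hx _

/-- Jacobi's triple product identity. -/
theorem theta_eq_infprod {x y : PowerSeries ℤ} (hx : X ∣ x) (hy : X ∣ y) (hx0 : x ≠ 0)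
    (hy0 : y ≠ 0) :
    theta x y = infprod (fun k => 1 + x * (x * y) ^ k) * infprod (fun k => 1 + y * (x * y) ^ k) *
      infprod (fun k => 1 - (x * y) ^ (k + 1)) := by
  set Q := x * y with hQ
  have hXQ : X ∣ Q := hx.mul_right y
  have hpx := X_pow_dvd_one_add_mul_pow_sub_one hx hXQ
  have hpy := X_pow_dvd_one_add_mul_pow_sub_one hy hXQ
  have hpq := X_pow_dvd_one_sub_pow_sub_one hXQ
  rw [infprod_mul hpx hpy]
  set e := infprod (fun k => 1 - Q ^ (k + 1)) with he
  have he1 : constantCoeff e = 1 := constantCoeff_infprod _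
  symm
  refine eq_infsum (X_pow_dvd_thetaTerm hx hy) fun M => ?_
  have hle := pow_dvd_pow (X : PowerSeries ℤ) (Nat.le_succ M)
  have hfin : ∀ j, M ≤ j → (X : PowerSeries ℤ) ^ M ∣ e - ∏ i ∈ range j, (1 - Q ^ (i + 1)) :=
    fun j hj => hle.trans (X_pow_dvd_infprod_sub hpq hj)
  -- A Gaussian binomial tends to 1/e when both of its lower indices grow: modulo `X ^ M` all three
  -- finite products in the quotient formula agree with e.
  have hg : ∀ k j, M ≤ k → M ≤ j → (X : PowerSeries ℤ) ^ M ∣ e * gaussBinom Q (k + j) k - 1 := by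
    intro k j hk hj
    refine X_pow_dvd_of_mul_left he1 ?_
    have h1 := gaussBinom_mul_prod_mul_prod Q k j
    obtain ⟨a, ha⟩ := hfin k hk
    obtain ⟨b, hb⟩ := hfin j hj
    obtain ⟨c, hc⟩ := hfin (k + j) (by omega)
    rw [← sub_eq_iff_eq_add'.2 (sub_eq_iff_eq_add.1 ha), ← sub_eq_iff_eq_add'.2 (sub_eq_iff_eq_add.1 hb),
      ← sub_eq_iff_eq_add'.2 (sub_eq_iff_eq_add.1 hc)] at h1
    refine ⟨gaussBinom Q (k + j) k * (a * e + b * e - X ^ M * a * b) - c, ?_⟩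
    linear_combination h1
  -- The finite identity is used with N = 2M: for n < M both 2M ± (n+1) are at least M, and for n ≥
  -- M the theta terms already vanish modulo `X ^ M`.
  have hprod := (hle.trans (X_pow_dvd_infprod_sub
    (fun k => X_pow_dvd_mul_sub_one (hpx k) (hpy k)) (by omega : M ≤ 2 * M))).mul_right e
  rw [finite_triple_product hx0 hy0] at hprod
  rw [sub_mul] at hprod
  have key : (X : PowerSeries ℤ) ^ M ∣ (gaussBinom Q (2 * (2 * M)) (2 * M) +
      ∑ n ∈ range (2 * M), (gaussBinom Q (2 * (2 * M)) (2 * M + (n + 1)) *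
            (x ^ (n + 2).choose 2 * y ^ (n + 1).choose 2) +
          gaussBinom Q (2 * (2 * M)) (2 * M - (n + 1)) *
            (x ^ (n + 1).choose 2 * y ^ (n + 2).choose 2))) * e -
      ∑ n ∈ range (2 * M + 1), thetaTerm x y n := by
    rw [sum_range_succ', add_mul, sum_mul, add_comm, add_sub_add_comm, ← sum_sub_distrib]
    refine dvd_add (dvd_sum fun n hn => ?_) ?_
    · have hn := mem_range.1 hn
      rcases lt_or_ge n M with h | h
      · have h1 := (hg (2 * M + (n + 1)) (2 * M - (n + 1)) (by omega) (by omega)).mul_right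
          (x ^ (n + 2).choose 2 * y ^ (n + 1).choose 2)
        have h2 := (hg (2 * M - (n + 1)) (2 * M + (n + 1)) (by omega) (by omega)).mul_right
          (x ^ (n + 1).choose 2 * y ^ (n + 2).choose 2)
        rw [show 2 * M + (n + 1) + (2 * M - (n + 1)) = 2 * (2 * M) by omega] at h1
        rw [show 2 * M - (n + 1) + (2 * M + (n + 1)) = 2 * (2 * M) by omega] at h2
        convert dvd_add h1 h2 using 1
        rw [thetaTerm]
        ring
      · have h1 : X ^ M ∣ x ^ (n + 2).choose 2 := (pow_dvd_pow X
          (h.trans ((Nat.le_succ n).trans (le_choose_succ_two (n + 1))))).trans (pow_dvd_pow_of_dvd hx _)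
        have h2 : X ^ M ∣ y ^ (n + 2).choose 2 := (pow_dvd_pow X
          (h.trans ((Nat.le_succ n).trans (le_choose_succ_two (n + 1))))).trans (pow_dvd_pow_of_dvd hy _)
        have h3 := h1.mul_right (y ^ (n + 1).choose 2)
        have h4 := h2.mul_left (x ^ (n + 1).choose 2)
        exact dvd_sub ((dvd_add (h3.mul_left _) (h4.mul_left _)).mul_right _) (dvd_add h3 h4)
    · have := hg (2 * M) (2 * M) (by omega) (by omega)
      rw [← two_mul] at this
      rwa [thetaTerm, mul_comm]
  have h5 := X_pow_dvd_sum_sub (X_pow_dvd_thetaTerm hx hy) (by omega : M ≤ 2 * M + 1)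
  convert dvd_add (dvd_add hprod key) h5 using 1
  ring

/-! ### Termwise operations on infinite sums. -/

section infsum

theorem infsum_add {f g : ℕ → PowerSeries ℤ} (hf : ∀ n, (X : PowerSeries ℤ) ^ n ∣ f n)
    (hg : ∀ n, (X : PowerSeries ℤ) ^ n ∣ g n) :
    infsum f + infsum g = infsum fun n => f n + g n := by
  refine eq_infsum (fun n => dvd_add (hf n) (hg n)) fun N => ?_
  rw [sum_add_distrib, add_sub_add_comm]
  exact dvd_add (X_pow_dvd_infsum_sub hf N) (X_pow_dvd_infsum_sub hg N)

theorem mul_infsum (a : PowerSeries ℤ) {f : ℕ → PowerSeries ℤ}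
    (hf : ∀ n, (X : PowerSeries ℤ) ^ n ∣ f n) :
    a * infsum f = infsum fun n => a * f n := by
  refine eq_infsum (fun n => (hf n).mul_left a) fun N => ?_
  rw [← mul_sum, ← mul_sub]
  exact (X_pow_dvd_infsum_sub hf N).mul_left a

theorem infsum_block {f : ℕ → PowerSeries ℤ} (hf : ∀ n, (X : PowerSeries ℤ) ^ n ∣ f n)
    {m : ℕ} (hm : 0 < m) : infsum f = infsum fun k => ∑ r ∈ range m, f (m * k + r) := by
  refine eq_infsum (fun n => dvd_sum fun r _ => (pow_dvd_pow X (by nlinarith)).trans (hf _))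
    fun N => ?_
  have h : ∑ k ∈ range N, ∑ r ∈ range m, f (m * k + r) = ∑ n ∈ range (m * N), f n := by
    induction N with
    | zero => simp
    | succ N ih => rw [sum_range_succ, ih, Nat.mul_succ, sum_range_add]
  rw [h]
  exact (pow_dvd_pow (X : PowerSeries ℤ) (by nlinarith)).trans (X_pow_dvd_infsum_sub hf (m * N))

/-- Regrouping two sums, one of them shifted by one index. -/
theorem infsum_add_shift {f g h : ℕ → PowerSeries ℤ} (hf : ∀ n, (X : PowerSeries ℤ) ^ n ∣ f n)
    (hg : ∀ n, (X : PowerSeries ℤ) ^ (n + 1) ∣ g n) (h0 : h 0 = f 0)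
    (hs : ∀ n, h (n + 1) = f (n + 1) + g n) : infsum h = infsum f + infsum g := by
  have hg' : ∀ n, (X : PowerSeries ℤ) ^ n ∣ g n := fun n =>
    (pow_dvd_pow X (Nat.le_succ n)).trans (hg n)
  symm
  have hh : ∀ n, (X : PowerSeries ℤ) ^ n ∣ h n := by
    rintro (_ | n)
    · simp
    · rw [hs]; exact dvd_add (hf _) (hg _)
  refine eq_infsum hh fun N => ?_
  have h1 : ∑ n ∈ range (N + 1), h n = ∑ n ∈ range (N + 1), f n + ∑ n ∈ range N, g n := by
    rw [sum_range_succ', h0, sum_range_succ' f, sum_congr rfl fun n _ => hs n, sum_add_distrib]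
    ring
  rw [sum_range_succ] at h1
  have h2 := X_pow_dvd_infsum_sub hg' N
  have h3 := (pow_dvd_pow X (Nat.le_succ N)).trans (X_pow_dvd_infsum_sub hf (N + 1))
  convert dvd_add (dvd_add h2 h3) (hh N) using 1
  rw [eq_sub_of_add_eq h1]
  ring

theorem X_pow_dvd_map {σ : PowerSeries ℤ →+* PowerSeries ℤ} (hσ : X ∣ σ X) {n : ℕ}
    {f : PowerSeries ℤ} (h : X ^ n ∣ f) : X ^ n ∣ σ f := by
  have := map_dvd σ h
  rw [map_pow] at this
  exact (pow_dvd_pow_of_dvd hσ n).trans this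

theorem map_infsum {σ : PowerSeries ℤ →+* PowerSeries ℤ} (hσ : X ∣ σ X)
    {f : ℕ → PowerSeries ℤ} (hf : ∀ n, (X : PowerSeries ℤ) ^ n ∣ f n) :
    σ (infsum f) = infsum fun n => σ (f n) := by
  refine eq_infsum (fun n => X_pow_dvd_map hσ (hf n)) fun N => ?_
  rw [← map_sum, ← map_sub]
  exact X_pow_dvd_map hσ (X_pow_dvd_infsum_sub hf N)

theorem map_theta {σ : PowerSeries ℤ →+* PowerSeries ℤ} (hσ : X ∣ σ X) {x y : PowerSeries ℤ}
    (hx : X ∣ x) (hy : X ∣ y) : σ (theta x y) = theta (σ x) (σ y) := by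
  rw [theta, map_infsum hσ (X_pow_dvd_thetaTerm hx hy), theta]
  congr 1
  ext1 n
  cases n <;> simp [thetaTerm]

end infsum

/-! ### Infinite q-products and Euler products. -/

/-- The infinite product `∏_{k ≥ 0} (1 + x y ^ k)`. -/
noncomputable def qprod (x y : PowerSeries ℤ) : PowerSeries ℤ := infprod fun k => 1 + x * y ^ k

section qprod
variable {x y u : PowerSeries ℤ}

theorem qprod_ne_zero (x y : PowerSeries ℤ) : qprod x y ≠ 0 := fun h => by
  have := constantCoeff_infprod fun k => 1 + x * y ^ k
  rw [← qprod, h, map_zero] at this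
  exact zero_ne_one this

theorem qprod_split_two (hx : X ∣ x) (hy : X ∣ y) :
    qprod x y = qprod x (y ^ 2) * qprod (x * y) (y ^ 2) := by
  have hy2 : X ∣ y ^ 2 := hy.trans (dvd_pow_self y two_ne_zero)
  rw [qprod, infprod_block (X_pow_dvd_one_add_mul_pow_sub_one hx hy) Nat.two_pos, qprod, qprod,
    infprod_mul (X_pow_dvd_one_add_mul_pow_sub_one hx hy2)
      (X_pow_dvd_one_add_mul_pow_sub_one (hx.mul_right y) hy2)]
  congr 1
  ext1 k
  rw [prod_range_succ, prod_range_one]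
  ring

theorem qprod_split_three (hx : X ∣ x) (hy : X ∣ y) :
    qprod x y = qprod x (y ^ 3) * qprod (x * y) (y ^ 3) * qprod (x * y ^ 2) (y ^ 3) := by
  have hy2 : X ∣ y ^ 3 := hy.trans (dvd_pow_self y three_ne_zero)
  have h0 := X_pow_dvd_one_add_mul_pow_sub_one hx hy2
  have h1 := X_pow_dvd_one_add_mul_pow_sub_one (hx.mul_right y) hy2
  have h2 := X_pow_dvd_one_add_mul_pow_sub_one (hx.mul_right (y ^ 2)) hy2
  rw [qprod, infprod_block (X_pow_dvd_one_add_mul_pow_sub_one hx hy) (Nat.succ_pos 2), qprod, qprod,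
    qprod, infprod_mul h0 h1, infprod_mul (fun k => X_pow_dvd_mul_sub_one (h0 k) (h1 k)) h2]
  congr 1
  ext1 k
  rw [prod_range_succ, prod_range_succ, prod_range_one]
  ring

theorem qprod_mul_qprod_neg (hx : X ∣ x) (hy : X ∣ y) :
    qprod x y * qprod (-x) y = qprod (-x ^ 2) (y ^ 2) := by
  rw [qprod, qprod, infprod_mul (X_pow_dvd_one_add_mul_pow_sub_one hx hy)
    (X_pow_dvd_one_add_mul_pow_sub_one (dvd_neg.2 hx) hy), qprod]
  congr 1
  ext1 k
  ring

theorem theta_eq_qprod (hx : X ∣ x) (hy : X ∣ y) (hx0 : x ≠ 0) (hy0 : y ≠ 0) :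
    theta x y = qprod x (x * y) * qprod y (x * y) * qprod (-(x * y)) (x * y) := by
  rw [theta_eq_infprod hx hy hx0 hy0, qprod, qprod, qprod]
  congr 2
  ext1 n
  ring

/-- The Euler product `∏_{k ≥ 1} (1 - u ^ k)`. -/
noncomputable def euler (u : PowerSeries ℤ) : PowerSeries ℤ := qprod (-u) u

theorem euler_ne_zero (u : PowerSeries ℤ) : euler u ≠ 0 := qprod_ne_zero _ _

theorem X_dvd_pow (hu : X ∣ u) {n : ℕ} (hn : n ≠ 0) : X ∣ u ^ n := hu.trans (dvd_pow_self u hn)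

theorem qprod_neg_odd_mul_euler (hu : X ∣ u) : qprod (-u) (u ^ 2) * euler (u ^ 2) = euler u := by
  rw [euler, euler, qprod_split_two (dvd_neg.2 hu) hu]
  congr 2
  ring

/-- Pairing u with -u turns the product into one with parameter u². As in the other product
formulas, denominators are cleared and removed later by cancelling nonzero Euler products. -/
theorem qprod_odd_mul (hu : X ∣ u) :
    qprod u (u ^ 2) * (euler u * euler (u ^ 4)) = euler (u ^ 2) ^ 2 := by
  have h1 := qprod_mul_qprod_neg hu (X_dvd_pow hu two_ne_zero)
  have h2 := qprod_neg_odd_mul_euler (X_dvd_pow hu two_ne_zero)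
  have h3 := qprod_neg_odd_mul_euler hu
  rw [show (u ^ 2) ^ 2 = u ^ 4 by ring] at *
  rw [← h1] at h2
  rw [← h3]
  linear_combination euler (u ^ 2) * h2

theorem qprod_self_mul_euler (hu : X ∣ u) : qprod u u * euler u = euler (u ^ 2) := by
  rw [euler, qprod_mul_qprod_neg hu hu, euler]

end qprod

/-! ### Product formulas and dissections of φ and ψ. -/

/-- `φ(u) = ∑_{n ∈ ℤ} u ^ (n ^ 2)`. -/
noncomputable def phi (u : PowerSeries ℤ) : PowerSeries ℤ := theta u u

/-- `ψ(u) = ∑_{n ≥ 0} u ^ (n (n + 1) / 2)`. -/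
noncomputable def psi (u : PowerSeries ℤ) : PowerSeries ℤ := theta u (u ^ 3)

section theta
variable {u : PowerSeries ℤ}

theorem phi_mul_euler (hu : X ∣ u) (hu0 : u ≠ 0) :
    phi u * (euler u ^ 2 * euler (u ^ 4) ^ 2) = euler (u ^ 2) ^ 5 := by
  have h := qprod_odd_mul hu
  rw [phi, theta_eq_qprod hu hu hu0 hu0, show u * u = u ^ 2 by ring, show qprod (-u ^ 2) (u ^ 2) = euler (u ^ 2) from rfl]
  linear_combination (qprod u (u ^ 2) * euler u * euler (u ^ 4) + euler (u ^ 2) ^ 2) *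
    euler (u ^ 2) * h

theorem phi_neg_mul_euler (hu : X ∣ u) (hu0 : u ≠ 0) :
    phi (-u) * euler (u ^ 2) = euler u ^ 2 := by
  have h := qprod_neg_odd_mul_euler hu
  rw [phi, theta_eq_qprod (dvd_neg.2 hu) (dvd_neg.2 hu) (neg_ne_zero.2 hu0) (neg_ne_zero.2 hu0),
    show -u * -u = u ^ 2 by ring, show qprod (-u ^ 2) (u ^ 2) = euler (u ^ 2) from rfl]
  linear_combination (qprod (-u) (u ^ 2) * euler (u ^ 2) + euler u) * h

theorem psi_mul_euler (hu : X ∣ u) (hu0 : u ≠ 0) : psi u * euler u = euler (u ^ 2) ^ 2 := by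
  have h := qprod_odd_mul hu
  have h2 := qprod_split_two hu (X_dvd_pow hu two_ne_zero)
  rw [psi, theta_eq_qprod hu (X_dvd_pow hu three_ne_zero) hu0 (pow_ne_zero 3 hu0),
    show u * u ^ 3 = u ^ 4 by ring, show qprod (-u ^ 4) (u ^ 4) = euler (u ^ 4) from rfl]
  rw [show (u ^ 2) ^ 2 = u ^ 4 by ring, show u * u ^ 2 = u ^ 3 by ring] at h2
  rw [← h, h2]
  ring

theorem phi_mul_phi_neg (hu : X ∣ u) (hu0 : u ≠ 0) : phi u * phi (-u) = phi (-u ^ 2) ^ 2 := by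
  have h1 := phi_mul_euler hu hu0
  have h2 := phi_neg_mul_euler hu hu0
  have h3 := phi_neg_mul_euler (X_dvd_pow hu two_ne_zero) (pow_ne_zero 2 hu0)
  rw [show (u ^ 2) ^ 2 = u ^ 4 by ring] at h3
  have e1 := euler_ne_zero u
  have e2 := euler_ne_zero (u ^ 2)
  have e4 := euler_ne_zero (u ^ 4)
  refine mul_right_cancel₀ (mul_ne_zero (mul_ne_zero (pow_ne_zero 2 e1) (pow_ne_zero 2 e4)) e2) ?_
  linear_combination phi (-u) * euler (u ^ 2) * h1 + euler (u ^ 2) ^ 5 * h2 - euler u ^ 2 *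
    euler (u ^ 2) * (phi (-u ^ 2) * euler (u ^ 4) + euler (u ^ 2) ^ 2) * h3

theorem phi_mul_psi_sq (hu : X ∣ u) (hu0 : u ≠ 0) : phi u * psi (u ^ 2) = psi u ^ 2 := by
  have h1 := phi_mul_euler hu hu0
  have h2 := psi_mul_euler hu hu0
  have h3 := psi_mul_euler (X_dvd_pow hu two_ne_zero) (pow_ne_zero 2 hu0)
  rw [show (u ^ 2) ^ 2 = u ^ 4 by ring] at h3
  have e1 := euler_ne_zero u
  have e2 := euler_ne_zero (u ^ 2)
  have e4 := euler_ne_zero (u ^ 4)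
  refine mul_right_cancel₀ (mul_ne_zero (mul_ne_zero (pow_ne_zero 2 e1) (pow_ne_zero 2 e4)) e2) ?_
  linear_combination psi (u ^ 2) * euler (u ^ 2) * h1 + euler (u ^ 2) ^ 5 * h3 - euler (u ^ 4) ^ 2 *
    euler (u ^ 2) * (psi u * euler u + euler (u ^ 2) ^ 2) * h2

/-- The factors of `qprod u u` split by exponent modulo 3; the triple product supplies the classes 1
and 2, and the class 0 is `qprod (u ^ 3) (u ^ 3)`. -/
theorem theta_one_two_mul_euler (hu : X ∣ u) (hu0 : u ≠ 0) :
    theta u (u ^ 2) * (euler u * euler (u ^ 6)) = euler (u ^ 2) * euler (u ^ 3) ^ 2 := by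
  have h1 := qprod_split_three hu hu
  have h2 := qprod_self_mul_euler hu
  have h3 := qprod_self_mul_euler (X_dvd_pow hu three_ne_zero)
  rw [show u * u = u ^ 2 by ring, show u * u ^ 2 = u ^ 3 by ring] at h1
  rw [h1] at h2
  rw [show (u ^ 3) ^ 2 = u ^ 6 by ring] at h3
  rw [theta_eq_qprod hu (X_dvd_pow hu two_ne_zero) hu0 (pow_ne_zero 2 hu0),
    show u * u ^ 2 = u ^ 3 by ring, show qprod (-u ^ 3) (u ^ 3) = euler (u ^ 3) from rfl, ← h2, ← h3]
  ring

theorem theta_neg_one_five_mul_euler (hu : X ∣ u) (hu0 : u ≠ 0) :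
    theta (-u) (-u ^ 5) * (euler (u ^ 3) * euler (u ^ 2)) = euler u * euler (u ^ 6) ^ 2 := by
  have h1 := qprod_split_three (dvd_neg.2 hu) (X_dvd_pow hu two_ne_zero)
  have h2 := qprod_neg_odd_mul_euler hu
  have h3 := qprod_neg_odd_mul_euler (X_dvd_pow hu three_ne_zero)
  rw [show -u * u ^ 2 = -u ^ 3 by ring, show -u * (u ^ 2) ^ 2 = -u ^ 5 by ring,
    show (u ^ 2) ^ 3 = u ^ 6 by ring] at h1
  rw [h1] at h2
  rw [show (u ^ 3) ^ 2 = u ^ 6 by ring] at h3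
  rw [theta_eq_qprod (dvd_neg.2 hu) (dvd_neg.2 (X_dvd_pow hu (by norm_num))) (neg_ne_zero.2 hu0)
    (neg_ne_zero.2 (pow_ne_zero 5 hu0)), show -u * -u ^ 5 = u ^ 6 by ring,
    show qprod (-u ^ 6) (u ^ 6) = euler (u ^ 6) from rfl, ← h2, ← h3]
  ring

theorem X_pow_dvd_pow (hu : X ∣ u) {n k : ℕ} (h : n ≤ k) : (X : PowerSeries ℤ) ^ n ∣ u ^ k :=
  (pow_dvd_pow X h).trans (pow_dvd_pow_of_dvd hu k)

theorem two_mul_choose_succ_two (n : ℕ) : 2 * (n + 1).choose 2 = n ^ 2 + n := by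
  have := two_mul_choose_two (n + 1)
  nlinarith

theorem choose_eq {n c : ℕ} (h : 2 * c = n ^ 2 + n) : (n + 1).choose 2 = c := by
  have := two_mul_choose_succ_two n
  omega

theorem psi_eq_infsum (hu : X ∣ u) : psi u = infsum fun n => u ^ (n + 1).choose 2 := by
  have h (k : ℕ) : (X : PowerSeries ℤ) ^ k ∣ u ^ (k + 1).choose 2 :=
    X_pow_dvd_pow hu (le_choose_succ_two k)
  rw [infsum_block h Nat.two_pos, psi, theta]
  simp only [sum_range_succ, range_zero, sum_empty, zero_add, add_zero]
  have h1 : ∀ n, (X : PowerSeries ℤ) ^ n ∣ u ^ (2 * n + 1).choose 2 := fun n =>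
    (pow_dvd_pow X (by omega)).trans (h _)
  have h2 : ∀ n, (X : PowerSeries ℤ) ^ (n + 1) ∣ u ^ (2 * n + 1 + 1).choose 2 := fun n =>
    (pow_dvd_pow X (by omega)).trans (h _)
  rw [← infsum_add h1 fun n => (pow_dvd_pow X (Nat.le_succ n)).trans (h2 n)]
  -- The theta term of index n+1 carries the triangular numbers of index 2n+2 and 2n+1, which belong
  -- to consecutive blocks of length two; hence the shift.
  refine infsum_add_shift h1 h2 (by simp [thetaTerm]) fun n => ?_
  rw [thetaTerm, ← pow_mul, ← pow_mul, ← pow_add, ← pow_add, add_comm]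
  have ha := two_mul_choose_succ_two (n + 1)
  have hb := two_mul_choose_succ_two n
  congr 2
  · exact (choose_eq (by nlinarith)).symm
  · exact (choose_eq (by nlinarith)).symm

theorem phi_eq_infsum : phi u = infsum fun n => if n = 0 then 1 else 2 * u ^ n ^ 2 := by
  rw [phi, theta]
  congr 1
  ext1 n
  cases n with
  | zero => simp [thetaTerm]
  | succ n =>
    have ha := two_mul_choose_succ_two (n + 1)
    have hb := two_mul_choose_succ_two n
    rw [thetaTerm, ← pow_add, ← pow_add, if_neg n.succ_ne_zero, two_mul]
    congr 2 <;> nlinarith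

theorem X_pow_dvd_phi_term (hu : X ∣ u) (n : ℕ) :
    (X : PowerSeries ℤ) ^ n ∣ if n = 0 then 1 else 2 * u ^ n ^ 2 := by
  split_ifs with h
  · simp [h]
  · exact (X_pow_dvd_pow hu (by nlinarith)).mul_left 2

/-- The 2-dissection of `φ`. -/
theorem phi_two_dissection (hu : X ∣ u) : phi u = phi (u ^ 4) + 2 * u * psi (u ^ 8) := by
  have h4 := X_dvd_pow hu (n := 4) (by norm_num)
  have h8 := X_dvd_pow hu (n := 8) (by norm_num)
  have h (k : ℕ) : (X : PowerSeries ℤ) ^ k ∣ (u ^ 8) ^ (k + 1).choose 2 :=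
    X_pow_dvd_pow h8 (le_choose_succ_two k)
  rw [phi_eq_infsum, phi_eq_infsum, psi_eq_infsum h8, infsum_block (X_pow_dvd_phi_term hu) Nat.two_pos,
    mul_infsum _ h, infsum_add (X_pow_dvd_phi_term h4) fun n => (h n).mul_left _]
  congr 1
  ext1 n
  simp only [sum_range_succ, range_zero, sum_empty, zero_add, add_zero]
  congr 1
  · simp only [mul_eq_zero, two_ne_zero, false_or, ← pow_mul]
    congr 3
    ring
  · rw [if_neg (by omega), mul_assoc, ← pow_mul, ← pow_succ']
    have := two_mul_choose_succ_two n
    congr 2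
    nlinarith

/-- The 3-dissection of `φ`. -/
theorem phi_three_dissection (hu : X ∣ u) :
    phi u = phi (u ^ 9) + 2 * u * theta (u ^ 3) (u ^ 15) := by
  have h9 := X_dvd_pow hu (n := 9) (by norm_num)
  have h1 (n : ℕ) : (X : PowerSeries ℤ) ^ n ∣ u ^ (9 * n ^ 2 + 6 * n) :=
    X_pow_dvd_pow hu (by nlinarith)
  have h2 (n : ℕ) : (X : PowerSeries ℤ) ^ (n + 1) ∣ u ^ (9 * n ^ 2 + 12 * n + 3) :=
    X_pow_dvd_pow hu (by nlinarith)
  have h2' (n : ℕ) : (X : PowerSeries ℤ) ^ n ∣ u ^ (9 * n ^ 2 + 12 * n + 3) :=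
    X_pow_dvd_pow hu (by nlinarith)
  have h3 : theta (u ^ 3) (u ^ 15) = infsum (fun n => u ^ (9 * n ^ 2 + 6 * n)) +
      infsum (fun n => u ^ (9 * n ^ 2 + 12 * n + 3)) := by
    refine infsum_add_shift h1 h2 (by simp [thetaTerm]) fun n => ?_
    rw [thetaTerm, ← pow_mul, ← pow_mul, ← pow_mul, ← pow_mul, ← pow_add, ← pow_add, add_comm]
    have ha := two_mul_choose_succ_two (n + 1)
    have hb := two_mul_choose_succ_two n
    congr 2 <;> nlinarith
  rw [h3, infsum_add h1 h2', phi_eq_infsum, phi_eq_infsum,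
    infsum_block (X_pow_dvd_phi_term hu) (Nat.succ_pos 2), mul_infsum _ fun n => dvd_add (h1 n) (h2' n),
    infsum_add (X_pow_dvd_phi_term h9) fun n => (dvd_add (h1 n) (h2' n)).mul_left _]
  congr 1
  ext1 n
  simp only [sum_range_succ, range_zero, sum_empty, zero_add, add_zero]
  rw [add_assoc]
  congr 1
  · simp only [mul_eq_zero, three_ne_zero, false_or, ← pow_mul]
    congr 3
    ring
  · rw [if_neg (by omega), if_neg (by omega)]
    ring

/-- The 3-dissection of `ψ`. -/
theorem psi_three_dissection (hu : X ∣ u) :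
    psi u = theta (u ^ 3) (u ^ 6) + u * psi (u ^ 9) := by
  have h9 := X_dvd_pow hu (n := 9) (by norm_num)
  have h (k : ℕ) : (X : PowerSeries ℤ) ^ k ∣ u ^ (k + 1).choose 2 :=
    X_pow_dvd_pow hu (le_choose_succ_two k)
  have h' (k : ℕ) : (X : PowerSeries ℤ) ^ k ∣ (u ^ 9) ^ (k + 1).choose 2 :=
    X_pow_dvd_pow h9 (le_choose_succ_two k)
  have h1 (n : ℕ) : (X : PowerSeries ℤ) ^ n ∣ u ^ (3 * n + 1).choose 2 :=
    (pow_dvd_pow X (by omega)).trans (h _)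
  have h2 (n : ℕ) : (X : PowerSeries ℤ) ^ (n + 1) ∣ u ^ (3 * n + 2 + 1).choose 2 :=
    (pow_dvd_pow X (by omega)).trans (h _)
  have h2' (n : ℕ) : (X : PowerSeries ℤ) ^ n ∣ u ^ (3 * n + 2 + 1).choose 2 :=
    (pow_dvd_pow X (by omega)).trans (h _)
  have h3 : theta (u ^ 3) (u ^ 6) = infsum (fun n => u ^ (3 * n + 1).choose 2) +
      infsum (fun n => u ^ (3 * n + 2 + 1).choose 2) := by
    refine infsum_add_shift h1 h2 (by simp [thetaTerm]) fun n => ?_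
    rw [thetaTerm, ← pow_mul, ← pow_mul, ← pow_mul, ← pow_mul, ← pow_add, ← pow_add, add_comm]
    have ha := two_mul_choose_succ_two (n + 1)
    have hb := two_mul_choose_succ_two n
    congr 2
    · exact (choose_eq (by nlinarith)).symm
    · exact (choose_eq (by nlinarith)).symm
  rw [h3, infsum_add h1 h2', psi_eq_infsum hu, psi_eq_infsum h9, infsum_block h (Nat.succ_pos 2),
    mul_infsum _ h', infsum_add (fun n => dvd_add (h1 n) (h2' n)) fun n => (h' n).mul_left _]
  congr 1
  ext1 n
  simp only [sum_range_succ, range_zero, sum_empty, zero_add, add_zero]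
  have e : u * (u ^ 9) ^ (n + 1).choose 2 = u ^ (3 * n + 1 + 1).choose 2 := by
    rw [← pow_mul, ← pow_succ']
    have := two_mul_choose_succ_two n
    congr 1
    exact (choose_eq (by nlinarith)).symm
  rw [e]
  ring

end theta

/-! ### Evaluation of the bilateral series behind v₀. -/

/-- The denominator `∏_{i < n} (1 + q ^ (2 i + 1) γ)`. -/
noncomputable def wellPoisedDenom (γ : PowerSeries ℤ) (n : ℕ) : PowerSeries ℤ :=
  ∏ i ∈ range n, (1 + X ^ (2 * i + 1) * γ)

/-- The `n`-th term of a well-poised bilateral series with parameter `γ`. -/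
noncomputable def wellPoisedTerm (γ : PowerSeries ℤ) (n : ℕ) : PowerSeries ℤ :=
  X ^ n ^ 2 * (∏ i ∈ range n, (X ^ (2 * i + 1) - γ)) * invOfUnit (wellPoisedDenom γ n) 1

/-- The bilateral series `∑_{n ∈ ℤ} q ^ (n ^ 2) ∏_{i < n} (q ^ (2 i + 1) - γ) / (1 + q ^ (2 i + 1) γ)`
with the terms of index `n` and `-n` grouped. -/
noncomputable def wellPoisedSum (γ : PowerSeries ℤ) : PowerSeries ℤ :=
  infsum fun n => if n = 0 then 1 else wellPoisedTerm γ n + wellPoisedTerm (-γ) n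

theorem wellPoisedDenom_mul_inv (γ : PowerSeries ℤ) (n : ℕ) :
    wellPoisedDenom γ n * invOfUnit (wellPoisedDenom γ n) 1 = 1 := by
  apply mul_invOfUnit
  simp [wellPoisedDenom, map_prod]

theorem X_pow_dvd_wellPoisedTerm (γ : PowerSeries ℤ) (n : ℕ) :
    (X : PowerSeries ℤ) ^ n ∣ wellPoisedTerm γ n :=
  ((pow_dvd_pow X (by nlinarith)).mul_right _).mul_right _

theorem X_pow_dvd_wellPoisedSum_term (γ : PowerSeries ℤ) (n : ℕ) :
    (X : PowerSeries ℤ) ^ n ∣ if n = 0 then 1 else wellPoisedTerm γ n + wellPoisedTerm (-γ) n := by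
  split_ifs with h
  · simp [h]
  · exact dvd_add (X_pow_dvd_wellPoisedTerm _ _) (X_pow_dvd_wellPoisedTerm _ _)

/-- The certificate for the telescoping of `wellPoisedTerm`. -/
noncomputable def wellPoisedCert (γ : PowerSeries ℤ) (n : ℕ) : PowerSeries ℤ :=
  γ * (1 - X ^ 2 * γ ^ 2) * X ^ (n + 1) ^ 2 * (∏ i ∈ range n, (X ^ (2 * i + 1) - γ)) *
    invOfUnit (wellPoisedDenom γ (n + 1)) 1

/-- All four expressions share the numerator product over i < n, and every denominator divides
`wellPoisedDenom γ (n + 2)`; what remains is a polynomial identity. -/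
theorem wellPoisedTerm_telescope (γ : PowerSeries ℤ) (n : ℕ) :
    (1 - X ^ 2 * γ ^ 2) * wellPoisedTerm γ (n + 1) -
      (1 + X ^ 2 * γ ^ 2) * wellPoisedTerm (X ^ 2 * γ) (n + 1) =
    wellPoisedCert γ (n + 1) - wellPoisedCert γ n := by
  have hI1 := wellPoisedDenom_mul_inv γ (n + 1)
  have hI2 := wellPoisedDenom_mul_inv γ (n + 2)
  have hI3 := wellPoisedDenom_mul_inv (X ^ 2 * γ) (n + 1)
  have hD : wellPoisedDenom γ (n + 2) = wellPoisedDenom γ (n + 1) * (1 + X ^ (2 * n + 3) * γ) := by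
    rw [wellPoisedDenom, prod_range_succ]; rfl
  have hD' : wellPoisedDenom γ (n + 2) = wellPoisedDenom (X ^ 2 * γ) (n + 1) * (1 + X * γ) := by
    rw [wellPoisedDenom, prod_range_succ', wellPoisedDenom]
    congr 1
    · exact prod_congr rfl fun i _ => by ring
    · ring
  have hN : ∏ i ∈ range (n + 1), (X ^ (2 * i + 1) - X ^ 2 * γ) =
      X ^ (2 * n + 1) * (1 - X * γ) * ∏ i ∈ range n, (X ^ (2 * i + 1) - γ) := by
    rw [prod_range_succ']
    have : ∏ i ∈ range n, (X ^ (2 * (i + 1) + 1) - X ^ 2 * γ) =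
        X ^ (2 * n) * ∏ i ∈ range n, (X ^ (2 * i + 1) - γ) := by
      have hc : (X : PowerSeries ℤ) ^ (2 * n) = ∏ i ∈ range n, X ^ 2 := by simp [pow_mul]
      rw [hc, ← prod_mul_distrib]
      exact prod_congr rfl fun i _ => by ring
    rw [this]
    ring
  rw [wellPoisedTerm, wellPoisedTerm, wellPoisedCert, wellPoisedCert, hN, prod_range_succ]
  set I1 := invOfUnit (wellPoisedDenom γ (n + 1)) 1
  set I2 := invOfUnit (wellPoisedDenom γ (n + 1 + 1)) 1
  set I3 := invOfUnit (wellPoisedDenom (X ^ 2 * γ) (n + 1)) 1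
  have e1 : I1 = (1 + X ^ (2 * n + 3) * γ) * I2 := by
    rw [hD] at hI2
    linear_combination (1 + X ^ (2 * n + 3) * γ) * I2 * hI1 - I1 * hI2
  have e3 : I3 = (1 + X * γ) * I2 := by
    rw [hD'] at hI2
    linear_combination (1 + X * γ) * I2 * hI3 - I3 * hI2
  rw [e1, e3]
  ring

theorem wellPoisedCert_zero (γ : PowerSeries ℤ) :
    wellPoisedCert γ 0 = γ * X * (1 - X * γ) := by
  have h := wellPoisedDenom_mul_inv γ 1
  rw [wellPoisedCert]
  simp only [wellPoisedDenom, zero_add, prod_range_one, mul_zero, pow_one] at *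
  rw [range_zero, prod_empty]
  linear_combination γ * X * (1 - X * γ) * h

/-- Telescoping for γ and -γ leaves the boundary terms `wellPoisedCert_zero`. Together they
contribute 2 q²γ², exactly offsetting the discrepancy -2 q²γ² of the index 0 terms. -/
theorem wellPoisedSum_contiguous (γ : PowerSeries ℤ) :
    (1 - X ^ 2 * γ ^ 2) * wellPoisedSum γ =
      (1 + X ^ 2 * γ ^ 2) * wellPoisedSum (X ^ 2 * γ) := by
  refine eq_of_forall_X_pow_dvd fun N => ?_
  have h1 := (pow_dvd_pow X (Nat.le_succ N)).trans
    (X_pow_dvd_infsum_sub (X_pow_dvd_wellPoisedSum_term γ) (N + 1))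
  have h2 := (pow_dvd_pow X (Nat.le_succ N)).trans
    (X_pow_dvd_infsum_sub (X_pow_dvd_wellPoisedSum_term (X ^ 2 * γ)) (N + 1))
  have hs : ∀ δ : PowerSeries ℤ, ∑ n ∈ range (N + 1),
      (if n = 0 then 1 else wellPoisedTerm δ n + wellPoisedTerm (-δ) n) =
      ∑ n ∈ range N, wellPoisedTerm δ (n + 1) + ∑ n ∈ range N, wellPoisedTerm (-δ) (n + 1) + 1 := by
    intro δ
    rw [sum_range_succ', ← sum_add_distrib]
    simp
  rw [hs] at h1 h2
  have ht : ∀ δ : PowerSeries ℤ, (1 - X ^ 2 * δ ^ 2) * ∑ n ∈ range N, wellPoisedTerm δ (n + 1) -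
      (1 + X ^ 2 * δ ^ 2) * ∑ n ∈ range N, wellPoisedTerm (X ^ 2 * δ) (n + 1) =
      wellPoisedCert δ N - wellPoisedCert δ 0 := by
    intro δ
    rw [mul_sum, mul_sum, ← sum_sub_distrib, ← sum_range_sub]
    exact sum_congr rfl fun n _ => wellPoisedTerm_telescope δ n
  have t1 := ht γ
  have t2 := ht (-γ)
  rw [wellPoisedCert_zero] at t1 t2
  have hc : ∀ δ : PowerSeries ℤ, X ^ N ∣ wellPoisedCert δ N := fun δ =>
    (((pow_dvd_pow X (by nlinarith)).mul_left _).mul_right _).mul_right _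
  rw [neg_sq, mul_neg] at t2
  rw [wellPoisedSum, wellPoisedSum]
  convert dvd_add (dvd_sub (h1.mul_left (1 - X ^ 2 * γ ^ 2)) (h2.mul_left (1 + X ^ 2 * γ ^ 2)))
    (dvd_add (hc γ) (hc (-γ))) using 1
  linear_combination t1 + t2

theorem wellPoisedSum_iterate (γ : PowerSeries ℤ) (N : ℕ) :
    (∏ k ∈ range N, (1 + -(X ^ 2 * γ ^ 2) * (X ^ 4) ^ k)) * wellPoisedSum γ =
      (∏ k ∈ range N, (1 + X ^ 2 * γ ^ 2 * (X ^ 4) ^ k)) * wellPoisedSum (X ^ (2 * N) * γ) := by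
  induction N with
  | zero => simp
  | succ N ih =>
    have h := wellPoisedSum_contiguous (X ^ (2 * N) * γ)
    rw [show X ^ 2 * (X ^ (2 * N) * γ) = X ^ (2 * (N + 1)) * γ by ring,
      show X ^ 2 * (X ^ (2 * N) * γ) ^ 2 = X ^ 2 * γ ^ 2 * (X ^ 4) ^ N by ring] at h
    rw [prod_range_succ, prod_range_succ]
    linear_combination (1 + -(X ^ 2 * γ ^ 2) * (X ^ 4) ^ N) * ih +
      (∏ k ∈ range N, (1 + X ^ 2 * γ ^ 2 * (X ^ 4) ^ k)) * h

/-- At δ = 0 the numerator product is q^(1+3+⋯+(2n-1)) = q^(n²) and the denominator is 1. -/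
theorem X_pow_dvd_wellPoisedTerm_sub {δ : PowerSeries ℤ} {M : ℕ} (hδ : X ^ M ∣ δ) (n : ℕ) :
    X ^ M ∣ wellPoisedTerm δ n - (X ^ 2) ^ n ^ 2 := by
  have h1 : X ^ M ∣ (∏ i ∈ range n, (X ^ (2 * i + 1) - δ)) - X ^ n ^ 2 := by
    induction n with
    | zero => simp
    | succ n ih =>
      rw [prod_range_succ, show (X : PowerSeries ℤ) ^ (n + 1) ^ 2 = X ^ n ^ 2 * X ^ (2 * n + 1) by ring]
      exact X_pow_dvd_mul_sub_mul ih (by rw [sub_sub_cancel_left, dvd_neg]; exact hδ)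
  have h2 : X ^ M ∣ wellPoisedDenom δ n - 1 :=
    Finset.prod_induction _ (fun a => (X : PowerSeries ℤ) ^ M ∣ a - 1)
      (fun a b => X_pow_dvd_mul_sub_one) (by simp) fun r _ => by
        rw [add_sub_cancel_left]; exact hδ.mul_left _
  have h3 : X ^ M ∣ invOfUnit (wellPoisedDenom δ n) 1 - 1 := by
    have := wellPoisedDenom_mul_inv δ n
    convert h2.mul_left (-invOfUnit (wellPoisedDenom δ n) 1) using 1
    linear_combination this
  rw [wellPoisedTerm]
  convert X_pow_dvd_mul_sub_mul (N := M) (a := X ^ n ^ 2 * ∏ i ∈ range n, (X ^ (2 * i + 1) - δ))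
    (b := X ^ n ^ 2 * X ^ n ^ 2) (by rw [← mul_sub]; exact h1.mul_left _) h3 using 1
  ring

theorem X_pow_dvd_wellPoisedSum_sub {δ : PowerSeries ℤ} {M : ℕ} (hδ : X ^ M ∣ δ) :
    X ^ M ∣ wellPoisedSum δ - phi (X ^ 2) := by
  have h1 := X_pow_dvd_infsum_sub (X_pow_dvd_wellPoisedSum_term δ) M
  have h2 := X_pow_dvd_infsum_sub (X_pow_dvd_phi_term (dvd_pow_self X two_ne_zero)) M
  have h3 : X ^ M ∣ ∑ n ∈ range M,
      (if n = 0 then 1 else wellPoisedTerm δ n + wellPoisedTerm (-δ) n) -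
      ∑ n ∈ range M, (if n = 0 then 1 else 2 * (X ^ 2) ^ n ^ 2) := by
    rw [← sum_sub_distrib]
    refine dvd_sum fun n _ => ?_
    split_ifs
    · simp
    · rw [two_mul, add_sub_add_comm]
      exact dvd_add (X_pow_dvd_wellPoisedTerm_sub hδ n)
        (X_pow_dvd_wellPoisedTerm_sub (dvd_neg.2 hδ) n)
  rw [wellPoisedSum, phi_eq_infsum]
  convert dvd_sub (dvd_add h1 h3) h2 using 1
  ring

theorem wellPoisedSum_mul_qprod (γ : PowerSeries ℤ) :
    qprod (-(X ^ 2 * γ ^ 2)) (X ^ 4) * wellPoisedSum γ =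
      qprod (X ^ 2 * γ ^ 2) (X ^ 4) * phi (X ^ 2) := by
  have hx : (X : PowerSeries ℤ) ∣ X ^ 2 * γ ^ 2 := (dvd_pow_self X two_ne_zero).mul_right _
  have hy : (X : PowerSeries ℤ) ∣ X ^ 4 := dvd_pow_self X four_ne_zero
  refine eq_of_forall_X_pow_dvd fun N => ?_
  have hle := pow_dvd_pow (X : PowerSeries ℤ) (Nat.le_succ N)
  have h1 := hle.trans (X_pow_dvd_infprod_sub
    (X_pow_dvd_one_add_mul_pow_sub_one (dvd_neg.2 hx) hy) (le_refl N))
  have h2 := hle.trans (X_pow_dvd_infprod_sub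
    (X_pow_dvd_one_add_mul_pow_sub_one hx hy) (le_refl N))
  have h3 : X ^ N ∣ wellPoisedSum (X ^ (2 * N) * γ) - phi (X ^ 2) :=
    X_pow_dvd_wellPoisedSum_sub ((pow_dvd_pow X (by omega)).mul_right _)
  have h5 := wellPoisedSum_iterate γ N
  rw [qprod, qprod]
  convert dvd_add (h1.mul_right (wellPoisedSum γ)) (dvd_sub (h3.mul_left
    (∏ k ∈ range N, (1 + X ^ 2 * γ ^ 2 * (X ^ 4) ^ k))) (h2.mul_right (phi (X ^ 2)))) using 1
  linear_combination h5

theorem X_pow_ne_zero (n : ℕ) : (X : PowerSeries ℤ) ^ n ≠ 0 := pow_ne_zero n X_ne_zero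

/-- At γ = 1 the two q-products are quotients of Euler products, and their ratio is φ(q²) / φ(-q⁴).
-/
theorem wellPoisedSum_one_mul_phi :
    wellPoisedSum 1 * phi (-X ^ 4) = phi (X ^ 2) ^ 2 := by
  have hu : (X : PowerSeries ℤ) ∣ X ^ 2 := dvd_pow_self X two_ne_zero
  have h := wellPoisedSum_mul_qprod 1
  have h1 := qprod_odd_mul hu
  have h2 := qprod_neg_odd_mul_euler hu
  have h3 := phi_mul_euler hu (X_pow_ne_zero 2)
  have h4 := phi_neg_mul_euler (X_dvd_pow hu two_ne_zero) (pow_ne_zero 2 (X_pow_ne_zero 2))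
  simp only [← pow_mul, one_pow, mul_one, Nat.reduceMul] at h h1 h2 h3 h4
  have e1 := euler_ne_zero (X ^ 2)
  have e4 := euler_ne_zero (X ^ 8)
  refine mul_right_cancel₀ (mul_ne_zero (pow_ne_zero 2 e1) (pow_ne_zero 2 e4)) ?_
  have h5 : wellPoisedSum 1 * (euler (X ^ 2) ^ 2 * euler (X ^ 8)) =
      phi (X ^ 2) * euler (X ^ 4) ^ 3 := by
    linear_combination euler (X ^ 4) * euler (X ^ 2) * euler (X ^ 8) * h +
      phi (X ^ 2) * euler (X ^ 4) * h1 - wellPoisedSum 1 * euler (X ^ 2) * euler (X ^ 8) * h2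
  linear_combination phi (-X ^ 4) * euler (X ^ 8) * h5 + phi (X ^ 2) * euler (X ^ 4) ^ 3 * h4 -
    phi (X ^ 2) * h3

theorem wellPoisedTerm_neg_one (n : ℕ) : wellPoisedTerm (-1) n = v0Term n := by
  have h1 : ∏ i ∈ range n, ((X : PowerSeries ℤ) ^ (2 * i + 1) - -1) = qPoch (-X) (X ^ 2) n :=
    prod_congr rfl fun i _ => by ring
  have h2 : wellPoisedDenom (-1) n = qPoch X (X ^ 2) n := prod_congr rfl fun i _ => by ring
  rw [wellPoisedTerm, v0Term, h1, h2]

/-- Under q ↦ -q the sign (-1)^(n²) of the monomial cancels the sign (-1)^n of the n numerator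
factors. -/
theorem wellPoisedTerm_one (n : ℕ) : wellPoisedTerm 1 n = evalNegHom (v0Term n) := by
  have h1 : evalNegHom (wellPoisedDenom (-1) n) = wellPoisedDenom 1 n := by
    rw [wellPoisedDenom, wellPoisedDenom, map_prod]
    refine prod_congr rfl fun i _ => ?_
    simp only [map_add, map_mul, map_pow, map_neg, map_one, evalNegHom_X]
    rw [Odd.neg_pow ⟨i, rfl⟩]
    ring
  have h2 := congrArg evalNegHom (wellPoisedDenom_mul_inv (-1) n)
  have h3 := wellPoisedDenom_mul_inv 1 n
  rw [map_mul, h1, map_one] at h2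
  have h4 : invOfUnit (wellPoisedDenom 1 n) 1 = evalNegHom (invOfUnit (wellPoisedDenom (-1) n) 1) := by
    linear_combination evalNegHom (invOfUnit (wellPoisedDenom (-1) n) 1) * h3 -
      invOfUnit (wellPoisedDenom 1 n) 1 * h2
  rw [← wellPoisedTerm_neg_one, wellPoisedTerm, wellPoisedTerm, map_mul, ← h4, map_mul, map_prod]
  congr 1
  rw [map_pow, evalNegHom_X]
  have h5 : (-1 : PowerSeries ℤ) ^ n ^ 2 = (-1) ^ n := by
    rcases Nat.even_or_odd n with h | h
    · rw [h.neg_one_pow, (h.pow_of_ne_zero two_ne_zero).neg_one_pow]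
    · rw [h.neg_one_pow, h.pow.neg_one_pow]
  have h6 : ∏ i ∈ range n, evalNegHom ((X : PowerSeries ℤ) ^ (2 * i + 1) - -1) =
      (-1) ^ n * ∏ i ∈ range n, (X ^ (2 * i + 1) - 1) := by
    have hc : (-1 : PowerSeries ℤ) ^ n = ∏ i ∈ range n, -1 := by simp
    rw [hc, ← prod_mul_distrib]
    refine prod_congr rfl fun i _ => ?_
    simp only [map_sub, map_pow, map_neg, map_one, evalNegHom_X]
    rw [Odd.neg_pow ⟨i, rfl⟩]
    ring
  rw [h6, neg_pow, h5]
  have : (-1 : PowerSeries ℤ) ^ n * (-1) ^ n = 1 := by rw [← mul_pow]; simp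
  linear_combination -(X ^ n ^ 2 * ∏ i ∈ range n, (X ^ (2 * i + 1) - 1 : PowerSeries ℤ)) * this

/-- The two halves of the bilateral series are the series of v₀ at q and at -q, so even coefficients
double. Index 0 is counted only once, which excludes N = 0. -/
theorem coeff_wellPoisedSum_one {N : ℕ} (hN : Even N) (h0 : N ≠ 0) :
    coeff N (wellPoisedSum 1) = 2 * v0 N := by
  rw [wellPoisedSum, infsum, coeff_mk, map_sum, v0, mul_sum]
  refine sum_congr rfl fun n _ => ?_
  split_ifs with h
  · subst h
    simp [v0Term, qPoch, coeff_one, h0]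
    have := qPoch_mul_invOfUnit 0
    simp only [qPoch, range_zero, prod_empty, one_mul] at this
    simp [this, coeff_one, h0]
  · rw [wellPoisedTerm_neg_one, wellPoisedTerm_one, map_add, evalNegHom, coeff_rescale,
      hN.neg_one_pow]
    ring

/-! ### Sections along arithmetic progressions. -/

section sec
variable {R : Type*} [CommRing R]

/-- The section `∑ a (k n + r) X ^ n` of the power series `∑ a n X ^ n`. -/
noncomputable def sec (k r : ℕ) (f : PowerSeries R) : PowerSeries R :=
  mk fun n => coeff (k * n + r) f

theorem coeff_sec (k r n : ℕ) (f : PowerSeries R) : coeff n (sec k r f) = coeff (k * n + r) f :=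
  coeff_mk _ _

theorem sec_add (k r : ℕ) (f g : PowerSeries R) : sec k r (f + g) = sec k r f + sec k r g := by
  ext n
  simp [coeff_sec]

/-- Sections are linear over series in `X ^ k`. Every extraction below therefore first brings the
denominator into that form. -/
theorem sec_expand_mul {k r : ℕ} (hk : k ≠ 0) (hr : r < k) (g f : PowerSeries R) :
    sec k r (expand k hk g * f) = g * sec k r f := by
  ext n
  rw [coeff_sec, coeff_mul, coeff_mul]
  symm
  refine sum_of_injOn (fun p => (k * p.1, k * p.2 + r)) ?_ ?_ ?_ ?_
  · rintro ⟨a, b⟩ - ⟨c, d⟩ - h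
    simp only [Prod.mk.injEq, add_left_inj, mul_eq_mul_left_iff, hk, or_false] at h
    exact Prod.ext h.1 h.2
  · rintro ⟨a, b⟩ h
    simp only [mem_coe, HasAntidiagonal.mem_antidiagonal] at h ⊢
    rw [← h]; ring
  · rintro ⟨a, b⟩ h h'
    rw [HasAntidiagonal.mem_antidiagonal] at h
    simp only [Set.mem_image, Prod.exists, not_exists, not_and, mem_coe,
      HasAntidiagonal.mem_antidiagonal] at h'
    rw [coeff_expand_of_not_dvd, zero_mul]
    rintro ⟨c, rfl⟩
    have hcn : c ≤ n := by
      by_contra hc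
      push Not at hc
      nlinarith [Nat.mul_le_mul_left k (Nat.succ_le_of_lt hc), h]
    obtain ⟨d, rfl⟩ := Nat.exists_eq_add_of_le hcn
    refine h' c d rfl ?_
    ext
    · rfl
    · simp only at h ⊢
      nlinarith
  · rintro ⟨a, b⟩ -
    rw [coeff_expand_mul, coeff_sec]

theorem sec_X_pow {k r s : ℕ} (hr : r < k) (hs : s < k) :
    sec k r (X ^ s : PowerSeries R) = if s = r then 1 else 0 := by
  ext n
  rw [coeff_sec, coeff_X_pow]
  split_ifs with h1 h2 h2
  · obtain rfl : n = 0 := by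
      by_contra hn
      have := Nat.le_mul_of_pos_right k (Nat.pos_of_ne_zero hn)
      omega
    simp
  · exfalso
    apply h2
    have := congrArg (· % k) h1
    simp only [Nat.mul_add_mod, Nat.mod_eq_of_lt hr, Nat.mod_eq_of_lt hs] at this
    exact this.symm
  · subst h2
    rw [coeff_one, if_neg]
    rintro rfl
    simp at h1
  · simp

theorem sec_expand_mul_X_pow {k r s : ℕ} (hk : k ≠ 0) (hr : r < k) (hs : s < k)
    (g : PowerSeries R) : sec k r (expand k hk g * X ^ s) = if s = r then g else 0 := by
  rw [sec_expand_mul hk hr, sec_X_pow hr hs]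
  split_ifs <;> simp

theorem expand_injective {k : ℕ} (hk : k ≠ 0) {f g : PowerSeries R}
    (h : expand k hk f = expand k hk g) : f = g := by
  ext n
  rw [← coeff_expand_mul k hk, h, coeff_expand_mul]

end sec

section
variable {u x y : PowerSeries ℤ} {k : ℕ} (hk : k ≠ 0)
include hk

theorem X_dvd_expand_X : (X : PowerSeries ℤ) ∣ (expand k hk : PowerSeries ℤ →ₐ[ℤ] _).toRingHom X := by
  change X ∣ expand k hk X
  rw [expand_X]
  exact dvd_pow_self X hk

theorem expand_theta (hx : X ∣ x) (hy : X ∣ y) :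
    expand k hk (theta x y) = theta (expand k hk x) (expand k hk y) :=
  map_theta (X_dvd_expand_X hk) hx hy

theorem expand_phi (hu : X ∣ u) : expand k hk (phi u) = phi (expand k hk u) :=
  expand_theta hk hu hu

theorem expand_psi (hu : X ∣ u) : expand k hk (psi u) = psi (expand k hk u) := by
  rw [psi, expand_theta hk hu (X_dvd_pow hu three_ne_zero), map_pow, psi]

end

theorem X_dvd_X_pow {n : ℕ} (hn : n ≠ 0) : (X : PowerSeries ℤ) ∣ X ^ n := dvd_pow_self X hn

theorem expand_phi_X_pow {k j : ℕ} (hk : k ≠ 0) (hj : j ≠ 0) :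
    expand k hk (phi (X ^ j)) = phi (X ^ (k * j)) := by
  rw [expand_phi hk (X_dvd_X_pow hj), map_pow, expand_X, pow_mul]

theorem expand_phi_neg_X_pow {k j : ℕ} (hk : k ≠ 0) (hj : j ≠ 0) :
    expand k hk (phi (-X ^ j)) = phi (-X ^ (k * j)) := by
  rw [expand_phi hk (dvd_neg.2 (X_dvd_X_pow hj)), map_neg, map_pow, expand_X, pow_mul]

theorem expand_psi_X_pow {k j : ℕ} (hk : k ≠ 0) (hj : j ≠ 0) :
    expand k hk (psi (X ^ j)) = psi (X ^ (k * j)) := by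
  rw [expand_psi hk (X_dvd_X_pow hj), map_pow, expand_X, pow_mul]

theorem expand_phi_X {k : ℕ} (hk : k ≠ 0) : expand k hk (phi X) = phi (X ^ k) := by
  simpa using expand_phi_X_pow hk one_ne_zero

theorem expand_phi_neg_X {k : ℕ} (hk : k ≠ 0) : expand k hk (phi (-X)) = phi (-X ^ k) := by
  simpa using expand_phi_neg_X_pow hk one_ne_zero

theorem expand_psi_X {k : ℕ} (hk : k ≠ 0) : expand k hk (psi X) = psi (X ^ k) := by
  simpa using expand_psi_X_pow hk one_ne_zero

/-! ### Generating functions of v₀(4n) and v₀(32n+4). -/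

theorem phi_neg_X_sq : phi (-X) ^ 2 = phi (X ^ 2) ^ 2 - 4 * X * psi (X ^ 4) ^ 2 := by
  have h2 : (2 : ℕ) ≠ 0 := two_ne_zero
  have h := phi_mul_phi_neg dvd_rfl (X_ne_zero (R := ℤ))
  have d1 := phi_two_dissection (dvd_refl (X : PowerSeries ℤ))
  have d2 := phi_two_dissection (dvd_neg.2 (dvd_refl (X : PowerSeries ℤ)))
  rw [Even.neg_pow (by decide), Even.neg_pow (by decide)] at d2
  rw [d1, d2] at h
  -- After X ↦ X² the claim is φ(X)φ(-X) = φ(-X²)² with both factors 2-dissected.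
  apply expand_injective h2
  simp only [map_sub, map_mul, map_pow, map_ofNat, expand_X, expand_phi_neg_X,
    expand_phi_X_pow h2 h2, expand_psi_X_pow h2 four_ne_zero, Nat.reduceMul]
  linear_combination -h

theorem phi_X_sq : phi X ^ 2 = phi (X ^ 2) ^ 2 + 4 * X * psi (X ^ 4) ^ 2 := by
  have hσ : (X : PowerSeries ℤ) ∣ evalNegHom X := by simp
  have h := congrArg evalNegHom phi_neg_X_sq
  simp only [map_sub, map_mul, map_pow, map_ofNat] at h
  rw [phi, map_theta hσ (by simp) (by simp), phi, map_theta hσ (X_dvd_X_pow two_ne_zero)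
    (X_dvd_X_pow two_ne_zero), psi, map_theta hσ (X_dvd_X_pow four_ne_zero)
    (X_dvd_pow (X_dvd_X_pow four_ne_zero) three_ne_zero)] at h
  simp only [map_neg, map_pow, evalNegHom_X, neg_neg] at h
  rw [Even.neg_pow (by decide), Even.neg_pow (by decide)] at h
  rw [phi, phi, psi]
  linear_combination h

theorem phi_X_pow_sq {k : ℕ} (hk : k ≠ 0) :
    phi (X ^ k) ^ 2 = phi (X ^ (k * 2)) ^ 2 + 4 * X ^ k * psi (X ^ (k * 4)) ^ 2 := by
  have h := congrArg (expand k hk) phi_X_sq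
  simpa only [map_add, map_mul, map_pow, map_ofNat, expand_X, expand_phi_X,
    expand_phi_X_pow hk two_ne_zero, expand_psi_X_pow hk four_ne_zero] using h

/-- The generating function of `2 v₀(4 n)`, up to the constant coefficient. -/
noncomputable def vFour : PowerSeries ℤ := sec 4 0 (wellPoisedSum 1)

theorem phi_neg_mul_vFour : phi (-X) * vFour = phi X ^ 2 := by
  have h4 : (4 : ℕ) ≠ 0 := four_ne_zero
  have h := wellPoisedSum_one_mul_phi
  rw [phi_X_pow_sq two_ne_zero] at h
  have e1 : phi (X ^ (2 * 2)) ^ 2 + 4 * X ^ 2 * psi (X ^ (2 * 4)) ^ 2 =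
      expand 4 h4 (phi X ^ 2) * X ^ 0 + expand 4 h4 (4 * psi (X ^ 2) ^ 2) * X ^ 2 := by
    simp only [map_mul, map_pow, map_ofNat, expand_phi_X, expand_psi_X_pow h4 two_ne_zero,
      Nat.reduceMul]
    ring
  rw [e1, ← expand_phi_neg_X h4, mul_comm] at h
  have := congrArg (sec 4 0) h
  rw [sec_expand_mul h4 (by norm_num), sec_add, sec_expand_mul_X_pow h4 (by norm_num) (by norm_num),
    sec_expand_mul_X_pow h4 (by norm_num) (by norm_num)] at this
  rw [vFour]
  simpa using this

/-- Repeated use of φ(u)φ(-u) = φ(-u²)² moves the denominator φ(-X) to φ(-X⁸)⁸, a series in X⁴,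
ready for the next section. -/
theorem vFour_mul_phi_neg_pow :
    phi (-X ^ 8) ^ 8 * vFour = phi X ^ 3 * phi (X ^ 2) ^ 2 * phi (X ^ 4) ^ 4 := by
  have h := phi_neg_mul_vFour
  have h1 := phi_mul_phi_neg dvd_rfl (X_ne_zero (R := ℤ))
  have h2 := phi_mul_phi_neg (X_dvd_X_pow two_ne_zero) (X_pow_ne_zero 2)
  have h4 := phi_mul_phi_neg (X_dvd_X_pow four_ne_zero) (X_pow_ne_zero 4)
  simp only [← pow_mul, Nat.reduceMul] at h2 h4
  have k1 : phi (-X ^ 2) ^ 2 * vFour = phi X ^ 3 := by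
    linear_combination phi X * h - vFour * h1
  have k2 : phi (-X ^ 4) ^ 4 * vFour = phi X ^ 3 * phi (X ^ 2) ^ 2 := by
    linear_combination phi (X ^ 2) ^ 2 * k1 -
      vFour * (phi (X ^ 2) * phi (-X ^ 2) + phi (-X ^ 4) ^ 2) * h2
  have k3 : (phi (X ^ 4) * phi (-X ^ 4)) ^ 4 = phi (-X ^ 8) ^ 8 := by rw [h4]; ring
  linear_combination phi (X ^ 4) ^ 4 * k2 - vFour * k3

theorem sec_four_one_vFour : phi (-X ^ 2) ^ 8 * sec 4 1 vFour =
    6 * psi (X ^ 2) * phi X ^ 8 + 32 * X * psi (X ^ 2) ^ 5 * phi X ^ 4 := by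
  have h4 : (4 : ℕ) ≠ 0 := four_ne_zero
  have h := vFour_mul_phi_neg_pow
  have d := phi_two_dissection (dvd_refl (X : PowerSeries ℤ))
  have e : phi X ^ 3 * phi (X ^ 2) ^ 2 * phi (X ^ 4) ^ 4 =
      expand 4 h4 (phi X ^ 9 + 48 * X * psi (X ^ 2) ^ 4 * phi X ^ 5) * X ^ 0 +
      expand 4 h4 (6 * psi (X ^ 2) * phi X ^ 8 + 32 * X * psi (X ^ 2) ^ 5 * phi X ^ 4) * X ^ 1 +
      expand 4 h4 (16 * psi (X ^ 2) ^ 2 * phi X ^ 7) * X ^ 2 +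
      expand 4 h4 (32 * psi (X ^ 2) ^ 3 * phi X ^ 6) * X ^ 3 := by
    have d2 := phi_X_pow_sq two_ne_zero
    simp only [map_add, map_mul, map_pow, map_ofNat, expand_X, expand_phi_X,
      expand_psi_X_pow h4 two_ne_zero, Nat.reduceMul] at d2 ⊢
    rw [d2, d]
    ring
  rw [e, ← expand_phi_neg_X_pow h4 two_ne_zero, ← map_pow] at h
  have := congrArg (sec 4 1) h
  rw [sec_expand_mul h4 (by norm_num), sec_add, sec_add, sec_add,
    sec_expand_mul_X_pow h4 (by norm_num) (by norm_num),
    sec_expand_mul_X_pow h4 (by norm_num) (by norm_num),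
    sec_expand_mul_X_pow h4 (by norm_num) (by norm_num),
    sec_expand_mul_X_pow h4 (by norm_num) (by norm_num)] at this
  simpa using this

/-- The generating function of `2 v₀(32 n + 4)`. -/
noncomputable def vThirtyTwo : PowerSeries ℤ := sec 2 0 (sec 4 1 vFour)

theorem phi_neg_pow_mul_vThirtyTwo :
    phi (-X) ^ 8 * vThirtyTwo = 6 * psi X * phi (-X) ^ 8 + 1024 * X * psi X ^ 9 := by
  have h2 : (2 : ℕ) ≠ 0 := two_ne_zero
  have h := sec_four_one_vFour
  have h1 := phi_X_sq
  have hn := phi_neg_X_sq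
  have h3 := phi_mul_psi_sq (X_dvd_X_pow two_ne_zero) (X_pow_ne_zero 2)
  have h5 := phi_mul_phi_neg dvd_rfl (X_ne_zero (R := ℤ))
  simp only [← pow_mul, Nat.reduceMul] at h3
  -- The odd part, which the section discards; 128 = 6·16 + 32 collects both terms. In the even
  -- part, 1024 = 6·128 + 32·8.
  obtain ⟨q, hq⟩ : ∃ q, expand 2 h2 q =
      128 * psi (X ^ 2) ^ 5 * (phi (X ^ 2) ^ 4 + 16 * X ^ 2 * psi (X ^ 4) ^ 4) := by
    use 128 * psi X ^ 5 * (phi X ^ 4 + 16 * X * psi (X ^ 2) ^ 4)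
    simp only [map_add, map_mul, map_pow, map_ofNat, expand_X, expand_phi_X,
      expand_psi_X, expand_psi_X_pow h2 two_ne_zero, Nat.reduceMul]
  have hp : expand 2 h2 (6 * psi X * phi (-X) ^ 8 + 1024 * X * psi X ^ 9) =
      6 * psi (X ^ 2) * phi (-X ^ 2) ^ 8 + 1024 * X ^ 2 * psi (X ^ 2) ^ 9 := by
    simp only [map_add, map_mul, map_pow, map_ofNat, expand_X, expand_phi_neg_X, expand_psi_X]
  set a := phi (X ^ 2)
  set b := psi (X ^ 4)
  set g := psi (X ^ 2)
  have k4 : phi X ^ 4 = a ^ 4 + 16 * X ^ 2 * b ^ 4 + 8 * X * g ^ 4 := by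
    rw [show phi X ^ 4 = (phi X ^ 2) ^ 2 by ring, h1,
      show g ^ 4 = (g ^ 2) ^ 2 by ring, ← h3]
    ring
  have k5 : (a ^ 4 + 16 * X ^ 2 * b ^ 4) ^ 2 = phi (-X ^ 2) ^ 8 + 64 * X ^ 2 * g ^ 8 := by
    have : phi (-X ^ 2) ^ 4 = a ^ 4 - 16 * X ^ 2 * b ^ 4 := by
      rw [show phi (-X ^ 2) ^ 4 = (phi (-X ^ 2) ^ 2) ^ 2 by ring, ← h5, mul_pow, h1, hn]
      ring
    rw [show phi (-X ^ 2) ^ 8 = (phi (-X ^ 2) ^ 4) ^ 2 by ring, this,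
      show g ^ 8 = (g ^ 2) ^ 4 by ring, ← h3]
    ring
  have k8 : phi X ^ 8 = phi (-X ^ 2) ^ 8 + 128 * X ^ 2 * g ^ 8 +
      16 * X * g ^ 4 * (a ^ 4 + 16 * X ^ 2 * b ^ 4) := by
    rw [show phi X ^ 8 = (phi X ^ 4) ^ 2 by ring, k4]
    linear_combination k5
  have e : 6 * g * phi X ^ 8 + 32 * X * g ^ 5 * phi X ^ 4 =
      expand 2 h2 (6 * psi X * phi (-X) ^ 8 + 1024 * X * psi X ^ 9) * X ^ 0 +
      expand 2 h2 q * X ^ 1 := by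
    rw [k8, k4, hp, hq]
    ring
  rw [e, ← expand_phi_neg_X h2, ← map_pow] at h
  have := congrArg (sec 2 0) h
  rw [sec_expand_mul h2 (by norm_num), sec_add,
    sec_expand_mul_X_pow h2 (by norm_num) (by norm_num),
    sec_expand_mul_X_pow h2 (by norm_num) (by norm_num)] at this
  rw [vThirtyTwo]
  simpa using this

theorem coeff_vThirtyTwo (n : ℕ) : coeff n vThirtyTwo = 2 * v0 (32 * n + 4) := by
  rw [vThirtyTwo, coeff_sec, coeff_sec, vFour, coeff_sec,
    show 4 * (4 * (2 * n + 0) + 1) + 0 = 32 * n + 4 by ring,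
    coeff_wellPoisedSum_one (by use 16 * n + 2; ring) (by omega)]

/-! ### Congruences modulo 3 and 27. -/

theorem three_ne : (3 : ℕ) ≠ 0 := three_ne_zero

theorem ofNat_dvd_iff (m : ℕ) [m.AtLeastTwo] {f : PowerSeries ℤ} :
    (OfNat.ofNat m : PowerSeries ℤ) ∣ f ↔ ∀ n, (OfNat.ofNat m : ℤ) ∣ coeff n f := by
  have hC : (OfNat.ofNat m : PowerSeries ℤ) = C (OfNat.ofNat m : ℤ) := (map_ofNat _ m).symm
  rw [hC]
  constructor
  · rintro ⟨g, rfl⟩ n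
    rw [coeff_C_mul]
    exact dvd_mul_right _ _
  · intro h
    choose g hg using h
    refine ⟨mk g, ?_⟩
    ext n
    rw [coeff_C_mul, coeff_mk, hg]

/-- The Frobenius congruence `f(X) ^ 3 ≡ f(X ^ 3)` modulo 3. -/
theorem exists_pow_three_eq (f : PowerSeries ℤ) : ∃ c, f ^ 3 = expand 3 three_ne f + 3 * c := by
  have : Fact (Nat.Prime 3) := ⟨Nat.prime_three⟩
  have h1 : ∀ g : PowerSeries (ZMod 3), expand 3 three_ne g = g ^ 3 := by
    intro g
    have h := MvPowerSeries.map_frobenius_expand (σ := Unit) (R := ZMod 3) 3 three_ne (f := g)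
    rw [ZMod.frobenius_zmod, MvPowerSeries.map_id] at h
    exact h
  have h2 : (3 : PowerSeries ℤ) ∣ f ^ 3 - expand 3 three_ne f := by
    refine (ofNat_dvd_iff 3).2 fun n => ?_
    have h3 : map (Int.castRingHom (ZMod 3)) (f ^ 3 - expand 3 three_ne f) = 0 := by
      rw [map_sub, map_pow, map_expand, h1, sub_self]
    have h4 := congrArg (coeff n) h3
    rw [coeff_map, map_zero, eq_intCast] at h4
    exact (ZMod.intCast_zmod_eq_zero_iff_dvd _ 3).1 h4
  obtain ⟨c, hc⟩ := h2
  exact ⟨c, by linear_combination hc⟩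

theorem dvd_sec {m f : PowerSeries ℤ} (k r : ℕ) (hm : m = 27 ∨ m = 3) (hk : k ≠ 0) (hr : r < k)
    (h : m ∣ f) : m ∣ sec k r f := by
  obtain ⟨g, rfl⟩ := h
  have : expand k hk m = m := by rcases hm with rfl | rfl <;> exact map_ofNat _ _
  rw [← this, sec_expand_mul hk hr, this]
  exact dvd_mul_right _ _

theorem sec_sub {R : Type*} [CommRing R] (k r : ℕ) (f g : PowerSeries R) :
    sec k r (f - g) = sec k r f - sec k r g := by
  ext n
  simp [coeff_sec]

theorem dvd_of_dvd_expand {f : PowerSeries ℤ} (h : 3 ∣ expand 3 three_ne f) : 3 ∣ f := by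
  have := dvd_sec 3 0 (Or.inr rfl) three_ne (by norm_num) h
  rw [← mul_one (expand 3 three_ne f), ← pow_zero X, sec_expand_mul_X_pow three_ne (by norm_num)
    (by norm_num)] at this
  simpa using this

theorem dvd_of_dvd_mul_of_constantCoeff {u f m : PowerSeries ℤ} (hu : constantCoeff u = 1)
    (h : m ∣ u * f) : m ∣ f := by
  have : IsUnit u := by rw [isUnit_iff_constantCoeff, hu]; exact isUnit_one
  exact (this.dvd_mul_left).1 h

theorem constantCoeff_theta (x y : PowerSeries ℤ) : constantCoeff (theta x y) = 1 := by
  rw [← coeff_zero_eq_constantCoeff_apply, theta, infsum, coeff_mk]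
  simp [thetaTerm]

/-- The generating function `∏ (1 + X ^ k)` of partitions into distinct parts. -/
noncomputable def distinctSeries : PowerSeries ℤ := qprod X X

theorem constantCoeff_distinctSeries : constantCoeff distinctSeries = 1 := constantCoeff_infprod _

theorem distinctSeries_mul_euler : distinctSeries * euler X = euler (X ^ 2) :=
  qprod_self_mul_euler dvd_rfl

theorem distinctSeries_pow_three_mul : distinctSeries ^ 3 * phi (-X) = psi X := by
  have h := distinctSeries_mul_euler
  have h1 := phi_neg_mul_euler dvd_rfl (X_ne_zero (R := ℤ))
  have h2 := psi_mul_euler dvd_rfl (X_ne_zero (R := ℤ))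
  have e1 := euler_ne_zero X
  have e2 := euler_ne_zero (X ^ 2)
  refine mul_right_cancel₀ (mul_ne_zero e2 e1) ?_
  rw [← h] at h1 h2 ⊢
  linear_combination distinctSeries ^ 3 * euler X * h1 - distinctSeries * euler X * h2

theorem distinctSeries_mul_phi : distinctSeries * phi (-X ^ 3) = theta X (X ^ 2) := by
  have h := distinctSeries_mul_euler
  have h1 := phi_neg_mul_euler (X_dvd_X_pow three_ne) (X_pow_ne_zero 3)
  have h2 := theta_one_two_mul_euler dvd_rfl (X_ne_zero (R := ℤ))
  simp only [← pow_mul, Nat.reduceMul] at h1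
  refine mul_right_cancel₀ (mul_ne_zero (euler_ne_zero X) (euler_ne_zero (X ^ 6))) ?_
  linear_combination distinctSeries * euler X * h1 + euler (X ^ 3) ^ 2 * h - h2

theorem distinctSeries_mul_theta : distinctSeries * theta (-X) (-X ^ 5) = psi (X ^ 3) := by
  have h := distinctSeries_mul_euler
  have h1 := psi_mul_euler (X_dvd_X_pow three_ne) (X_pow_ne_zero 3)
  have h2 := theta_neg_one_five_mul_euler dvd_rfl (X_ne_zero (R := ℤ))
  simp only [← pow_mul, Nat.reduceMul] at h1
  refine mul_right_cancel₀ (mul_ne_zero (mul_ne_zero (euler_ne_zero (X ^ 3)) (euler_ne_zero (X ^ 2)))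
    (euler_ne_zero X)) ?_
  linear_combination distinctSeries * euler X * h2 + euler X * euler (X ^ 6) ^ 2 * h -
    euler (X ^ 2) * euler X * h1

theorem phi_neg_X_dissection : phi (-X) = expand 3 three_ne (phi (-X ^ 3)) -
    2 * X * expand 3 three_ne (theta (-X) (-X ^ 5)) := by
  have h := phi_three_dissection (dvd_neg.2 (dvd_refl (X : PowerSeries ℤ)))
  rw [Odd.neg_pow (by decide), Odd.neg_pow (by decide), Odd.neg_pow (by decide)] at h
  rw [expand_phi_neg_X_pow three_ne three_ne, expand_theta three_ne (by simp)
    (dvd_neg.2 (X_dvd_X_pow (by norm_num))), h]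
  simp only [map_neg, map_pow, expand_X, ← pow_mul, Nat.reduceMul]
  ring

/-- The components of ψ are those of φ(-X) times D(X³). This common shape makes the quotient ψ /
φ(-X) = D³ tractable. -/
theorem psi_X_dissection : psi X = expand 3 three_ne distinctSeries *
    (expand 3 three_ne (phi (-X ^ 3)) + X * expand 3 three_ne (theta (-X) (-X ^ 5))) := by
  have h := psi_three_dissection (dvd_refl (X : PowerSeries ℤ))
  have h1 := congrArg (expand 3 three_ne) distinctSeries_mul_phi
  have h2 := congrArg (expand 3 three_ne) distinctSeries_mul_theta
  rw [map_mul, expand_theta three_ne dvd_rfl (X_dvd_X_pow two_ne_zero)] at h1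
  rw [map_mul, expand_psi_X_pow three_ne three_ne] at h2
  simp only [map_pow, expand_X, ← pow_mul, Nat.reduceMul] at h1 h2
  rw [h, ← h1, ← h2]
  ring

/-- The modular function part of the generating function of `v₀(32 n + 4)`. -/
noncomputable def vPart : PowerSeries ℤ := X * distinctSeries ^ 27 * phi (-X)

theorem phi_neg_X_ne_zero : phi (-X) ≠ 0 := fun h => by
  have := constantCoeff_theta (-X) (-X)
  rw [← phi, h, map_zero] at this
  exact zero_ne_one this

theorem vThirtyTwo_eq : vThirtyTwo = 6 * psi X + 1024 * vPart := by
  have h := phi_neg_pow_mul_vThirtyTwo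
  have h1 := distinctSeries_pow_three_mul
  refine mul_left_cancel₀ (pow_ne_zero 8 phi_neg_X_ne_zero) ?_
  rw [h, vPart, show psi X ^ 9 = (distinctSeries ^ 3 * phi (-X)) ^ 9 by rw [h1]]
  ring

/-- Each cubing raises the modulus of a congruence from 3^k to 3^(k+1), starting from the Frobenius
congruence for D³. -/
theorem distinctSeries_pow_congr : (27 : PowerSeries ℤ) ∣
    distinctSeries ^ 27 - expand 3 three_ne (distinctSeries ^ 9) := by
  obtain ⟨c, hc⟩ := exists_pow_three_eq distinctSeries
  rw [map_pow]
  set w := expand 3 three_ne distinctSeries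
  set d := w ^ 2 * c + 3 * w * c ^ 2 + 3 * c ^ 3 with hd
  have h9 : distinctSeries ^ 9 = w ^ 3 + 9 * d := by
    rw [show distinctSeries ^ 9 = (distinctSeries ^ 3) ^ 3 by ring, hc, hd]
    ring
  refine ⟨w ^ 6 * d + 9 * w ^ 3 * d ^ 2 + 27 * d ^ 3, ?_⟩
  rw [show distinctSeries ^ 27 = (distinctSeries ^ 9) ^ 3 by ring, h9]
  ring

theorem sec_vPart_congr : (27 : PowerSeries ℤ) ∣
    sec 3 0 (sec 3 1 vPart) - phi (-X) * sec 3 0 (distinctSeries ^ 9) := by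
  have h3 := three_ne
  obtain ⟨c, hc⟩ := distinctSeries_pow_congr
  have e : vPart = expand 3 h3 (distinctSeries ^ 9 * phi (-X ^ 3)) * X ^ 1 +
      expand 3 h3 (-2 * distinctSeries ^ 9 * theta (-X) (-X ^ 5)) * X ^ 2 +
      27 * (c * (X * phi (-X))) := by
    rw [vPart, sub_eq_iff_eq_add.1 hc, map_mul, map_mul, map_mul, map_neg, map_ofNat]
    linear_combination X * expand 3 h3 (distinctSeries ^ 9) * phi_neg_X_dissection
  have h1 : 27 ∣ sec 3 1 vPart - distinctSeries ^ 9 * phi (-X ^ 3) := by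
    rw [e, sec_add, sec_add, sec_expand_mul_X_pow h3 (by norm_num) (by norm_num),
      sec_expand_mul_X_pow h3 (by norm_num) (by norm_num)]
    simpa using dvd_sec 3 1 (Or.inl rfl) h3 (by norm_num) (dvd_mul_right 27 (c * (X * phi (-X))))
  have h2 := dvd_sec 3 0 (Or.inl rfl) h3 (by norm_num) h1
  rwa [sec_sub, mul_comm, ← expand_phi_neg_X h3, sec_expand_mul h3 (by norm_num)] at h2

/-- In D³ = ψ / φ(-X), multiplying by A² + 2AXB + 4X²B², where φ(-X) = A - 2XB, makes the
denominator a series in X³. The numerator becomes E + 3Z with E in X³ and Z supported on exponents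
not divisible by 3. In its cube, 9E²Z disappears from the section and the rest of the difference
from E³ is divisible by 27. -/
theorem sec_distinctSeries_pow_congr : (27 : PowerSeries ℤ) ∣
    (phi (-X ^ 3) ^ 3 - 8 * X * theta (-X) (-X ^ 5) ^ 3) ^ 3 * sec 3 0 (distinctSeries ^ 9) -
      distinctSeries ^ 3 * (phi (-X ^ 3) ^ 3 + 4 * X * theta (-X) (-X ^ 5) ^ 3) ^ 3 := by
  have h3 := three_ne
  have h := distinctSeries_pow_three_mul
  rw [phi_neg_X_dissection, psi_X_dissection] at h
  set v := distinctSeries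
  set a := phi (-X ^ 3)
  set w := theta (-X) (-X ^ 5)
  set e := a ^ 3 + 4 * X * w ^ 3 with he
  have h1 : v ^ 3 * (expand 3 h3 a ^ 3 - 8 * X ^ 3 * expand 3 h3 w ^ 3) = expand 3 h3 v *
      (expand 3 h3 a ^ 3 + 4 * X ^ 3 * expand 3 h3 w ^ 3 + 3 * (expand 3 h3 a ^ 2 * X *
        expand 3 h3 w + 2 * expand 3 h3 a * X ^ 2 * expand 3 h3 w ^ 2)) := by
    linear_combination (expand 3 h3 a ^ 2 + 2 * expand 3 h3 a * X * expand 3 h3 w +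
      4 * X ^ 2 * expand 3 h3 w ^ 2) * h
  have h2 : expand 3 h3 ((a ^ 3 - 8 * X * w ^ 3) ^ 3) * v ^ 9 =
      expand 3 h3 (v ^ 3 * e ^ 3) * X ^ 0 + expand 3 h3 (9 * v ^ 3 * e ^ 2 * a ^ 2 * w) * X ^ 1 +
      expand 3 h3 (18 * v ^ 3 * e ^ 2 * a * w ^ 2) * X ^ 2 +
      27 * (expand 3 h3 v ^ 3 * (expand 3 h3 e * (expand 3 h3 a ^ 2 * X *
        expand 3 h3 w + 2 * expand 3 h3 a * X ^ 2 * expand 3 h3 w ^ 2) ^ 2 +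
        (expand 3 h3 a ^ 2 * X *
        expand 3 h3 w + 2 * expand 3 h3 a * X ^ 2 * expand 3 h3 w ^ 2) ^ 3)) := by
    have h4 := congrArg (· ^ 3) h1
    simp only [he, map_add, map_sub, map_mul, map_pow, map_ofNat, expand_X] at h4 ⊢
    linear_combination h4
  have h5 := congrArg (sec 3 0) h2
  rw [sec_expand_mul h3 (by norm_num), sec_add, sec_add, sec_add,
    sec_expand_mul_X_pow h3 (by norm_num) (by norm_num),
    sec_expand_mul_X_pow h3 (by norm_num) (by norm_num),
    sec_expand_mul_X_pow h3 (by norm_num) (by norm_num)] at h5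
  rw [h5]
  simpa using dvd_sec 3 0 (Or.inl rfl) h3 (by norm_num) (dvd_mul_right (27 : PowerSeries ℤ) _)

/-- Cubing the 3-dissection of ψ and using ψ(X)³ ≡ ψ(X³) modulo 3 gives the claim with X³ in place
of X. -/
theorem psi_congr : (3 : PowerSeries ℤ) ∣ psi X - distinctSeries ^ 3 *
    (phi (-X ^ 3) ^ 3 + X * theta (-X) (-X ^ 5) ^ 3) := by
  apply dvd_of_dvd_expand
  obtain ⟨c, hc⟩ := exists_pow_three_eq (psi X)
  have h := psi_X_dissection
  simp only [map_add, map_sub, map_mul, map_pow, expand_X]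
  rw [eq_sub_of_add_eq hc.symm, h]
  set v := expand 3 three_ne distinctSeries
  set a := expand 3 three_ne (phi (-X ^ 3))
  set w := expand 3 three_ne (theta (-X) (-X ^ 5))
  exact ⟨v ^ 3 * (a ^ 2 * X * w + a * X ^ 2 * w ^ 2) - c, by ring⟩

/-- With m = a³ + y and y = Xw³, the section is ψ (m+3y)³ / (m-9y)³ ≡ ψ (1 + 9y/m) modulo 27. Only
y/m modulo 3 matters: D³m ≡ ψ, and D³y = X ψ(X³)³ ≡ X ψ(X⁹), so ψ y/m ≡ X ψ(X⁹). -/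
theorem sec_sec_vPart_congr : (27 : PowerSeries ℤ) ∣
    sec 3 0 (sec 3 1 vPart) - (psi X + 9 * X * psi (X ^ 9)) := by
  obtain ⟨c1, h1⟩ := sec_vPart_congr
  obtain ⟨c2, h2⟩ := sec_distinctSeries_pow_congr
  obtain ⟨s, hs⟩ := psi_congr
  obtain ⟨t, ht⟩ := exists_pow_three_eq (psi (X ^ 3))
  rw [expand_psi_X_pow three_ne three_ne, ← distinctSeries_mul_theta] at ht
  have h := distinctSeries_pow_three_mul
  have hv := constantCoeff_distinctSeries
  have ha : constantCoeff (phi (-X ^ 3)) = 1 := constantCoeff_theta _ _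
  simp only [Nat.reduceMul] at ht
  rw [sub_eq_iff_eq_add.1 h1]
  set v := distinctSeries
  set a := phi (-X ^ 3)
  set w := theta (-X) (-X ^ 5)
  set N := sec 3 0 (v ^ 9)
  set m := a ^ 3 + X * w ^ 3 with hm
  set y := X * w ^ 3 with hy
  -- Multiplying by a series with constant term 1 clears the denominators without affecting
  -- divisibility.
  have hu : constantCoeff (v ^ 3 * (m - 9 * y) ^ 3) = 1 := by
    simp [hm, hy, hv, ha]
  refine dvd_of_dvd_mul_of_constantCoeff hu ?_
  rw [show a ^ 3 - 8 * X * w ^ 3 = m - 9 * y by rw [hm, hy]; ring,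
    show a ^ 3 + 4 * X * w ^ 3 = m + 3 * y by rw [hm, hy]; ring] at h2
  have e1 : v ^ 3 * y = X * (psi (X ^ 9) + 3 * t) := by rw [hy, ← ht]; ring
  have e2 : v ^ 3 * m = psi X - 3 * s := by rw [← hs]; ring
  have key : v ^ 3 * (m - 9 * y) ^ 3 * (27 * c1 + phi (-X) * N - (psi X + 9 * X * psi (X ^ 9))) =
      27 * (v ^ 3 * (m - 9 * y) ^ 3 * c1 + v ^ 3 * phi (-X) * c2) +
      v ^ 3 * (psi X * ((m + 3 * y) ^ 3 - (m - 9 * y) ^ 3) -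
        9 * X * psi (X ^ 9) * (m - 9 * y) ^ 3) := by
    linear_combination v ^ 3 * phi (-X) * h2 + v ^ 3 * (m + 3 * y) ^ 3 * h
  rw [key]
  refine dvd_add (dvd_mul_right _ _) ?_
  have e3 : v ^ 3 * (psi X * ((m + 3 * y) ^ 3 - (m - 9 * y) ^ 3) -
      9 * X * psi (X ^ 9) * (m - 9 * y) ^ 3) =
      9 * m ^ 2 * (psi X * (v ^ 3 * y) - X * psi (X ^ 9) * (v ^ 3 * m)) +
      27 * v ^ 3 * (psi X * (m ^ 2 * y - 8 * m * y ^ 2 + 28 * y ^ 3) +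
        9 * X * psi (X ^ 9) * (m ^ 2 * y - 9 * m * y ^ 2 + 27 * y ^ 3)) := by
    ring
  rw [e3, e1, e2]
  refine ⟨m ^ 2 * (psi X * X * t + X * psi (X ^ 9) * s) +
    v ^ 3 * (psi X * (m ^ 2 * y - 8 * m * y ^ 2 + 28 * y ^ 3) +
        9 * X * psi (X ^ 9) * (m ^ 2 * y - 9 * m * y ^ 2 + 27 * y ^ 3)), by ring⟩

/-! ### Supports on squares and the three families. -/

theorem coeff_psi_X_eq_zero {n : ℕ} (h : ¬IsSquare (8 * n + 1)) : coeff n (psi X) = 0 := by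
  rw [psi_eq_infsum dvd_rfl, infsum, coeff_mk, map_sum]
  refine sum_eq_zero fun k _ => ?_
  rw [coeff_X_pow, if_neg]
  rintro rfl
  exact h ⟨2 * k + 1, by nlinarith [two_mul_choose_succ_two k]⟩

/-- If n = 9k + 1 then 8n + 1 = 9(8k + 1), so this support also consists of n with 8n+1 a square. -/
theorem coeff_X_mul_psi_eq_zero {n : ℕ} (h : ¬IsSquare (8 * n + 1)) :
    coeff n (X * psi (X ^ 9)) = 0 := by
  rw [← expand_psi_X (by norm_num : 9 ≠ 0)]
  cases n with
  | zero => simp at h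
  | succ n =>
    rw [coeff_succ_X_mul]
    by_cases hn : 9 ∣ n
    · obtain ⟨k, rfl⟩ := hn
      rw [coeff_expand_mul]
      refine coeff_psi_X_eq_zero fun ⟨r, hr⟩ => h ⟨3 * r, ?_⟩
      linarith
    · exact coeff_expand_of_not_dvd _ _ _ hn

theorem isSquare_of_isSquare_sq_mul {k m : ℕ} (hk : k ≠ 0) (h : IsSquare (k ^ 2 * m)) :
    IsSquare m := by
  obtain ⟨s, hs⟩ := h
  rw [← sq] at hs
  obtain ⟨t, rfl⟩ := (Nat.pow_dvd_pow_iff two_ne_zero).1 (Dvd.intro m hs)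
  refine ⟨t, Nat.eq_of_mul_eq_mul_left (pow_pos (Nat.pos_of_ne_zero hk) 2) ?_⟩
  rw [hs]
  ring

theorem v0_congr_of_not_isSquare {j : ℕ} (h : ¬IsSquare (8 * j + 1)) :
    v0 (36 * (8 * j + 1)) ≡ 0 [ZMOD 27] := by
  have h9 : ¬IsSquare (8 * (9 * j + 1) + 1) := fun h' => h <| by
    rw [show 8 * (9 * j + 1) + 1 = 3 ^ 2 * (8 * j + 1) by ring] at h'
    exact isSquare_of_isSquare_sq_mul three_ne h'
  have h1 := (ofNat_dvd_iff 27).1 sec_sec_vPart_congr j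
  have h2 := congrArg (coeff (9 * j + 1)) vThirtyTwo_eq
  have hC6 : (6 : PowerSeries ℤ) = C 6 := (map_ofNat C 6).symm
  have hC9 : (9 : PowerSeries ℤ) = C 9 := (map_ofNat C 9).symm
  have hC1024 : (1024 : PowerSeries ℤ) = C 1024 := (map_ofNat C 1024).symm
  rw [map_sub, coeff_sec, coeff_sec, map_add, coeff_psi_X_eq_zero h, hC9, mul_assoc, coeff_C_mul,
    coeff_X_mul_psi_eq_zero h, show 3 * (3 * j + 0) + 1 = 9 * j + 1 by ring] at h1
  rw [coeff_vThirtyTwo, map_add, hC6, hC1024, coeff_C_mul, coeff_C_mul, coeff_psi_X_eq_zero h9,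
    show 32 * (9 * j + 1) + 4 = 36 * (8 * j + 1) by ring] at h2
  rw [Int.modEq_zero_iff_dvd]
  simp only [mul_zero, add_zero, sub_zero, zero_add] at h1 h2
  have h1' : (27 : ℤ) ∣ coeff (9 * j + 1) vPart := h1
  -- Here 2 v₀ equals 1024 times a multiple of 27, and 2 is invertible modulo 27.
  omega

theorem sq_mod_eight_of_odd {k : ℕ} (hk : Odd k) : k ^ 2 % 8 = 1 := by
  have h : k % 8 = 1 ∨ k % 8 = 3 ∨ k % 8 = 5 ∨ k % 8 = 7 := by
    have := Nat.odd_iff.1 hk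
    omega
  rcases h with h | h | h | h <;> rw [Nat.pow_mod, h]

/-- The argument equals 36 (3k)² m, and (3k)² m ≡ 1 mod 8 is a square only if m is. -/
theorem v0_congr_of_odd {k m : ℕ} (hk : Odd k) (hm : m % 8 = 1) (h : ¬IsSquare m) :
    v0 (k ^ 2 * 9 ^ 2 * (4 * m)) ≡ 0 [ZMOD 27] := by
  have h8 : (3 * k) ^ 2 * m % 8 = 1 := by
    have h3 : Odd (3 * k) := (by decide : Odd 3).mul hk
    have := sq_mod_eight_of_odd h3
    rw [Nat.mul_mod, this, hm]
  have hj := Nat.div_add_mod ((3 * k) ^ 2 * m) 8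
  rw [h8] at hj
  have hk0 : 3 * k ≠ 0 := by have := hk.pos; omega
  have := v0_congr_of_not_isSquare (j := (3 * k) ^ 2 * m / 8) (by
    rw [hj]; exact fun h' => h (isSquare_of_isSquare_sq_mul hk0 h'))
  rw [hj] at this
  convert this using 2
  ring

end QSeries

open QSeries in
theorem mainTheorem10 (p : ℕ) [Fact p.Prime] (hp : 3 ≤ p) (α n : ℕ) :
    ((¬ ∃ k : ℕ, n = k * (k + 1) / 2) →
      v0 (p ^ (2 * α) * 9 ^ 2 * (32 * n + 4)) ≡ 0 [ZMOD 27]) ∧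
    (∀ i : ℕ, 1 ≤ i → i ≤ p - 1 →
      v0 (p ^ (2 * α + 1) * 9 ^ 2 * (32 * p * n + 32 * i + 4 * p)) ≡ 0 [ZMOD 27]) ∧
    (∀ j : ℕ, legendreSym p (8 * (j : ℤ) + 1) = -1 →
      v0 (p ^ (2 * α) * 9 ^ 2 * (32 * p * n + 32 * j + 4)) ≡ 0 [ZMOD 27]) := by
  have hpp : p.Prime := Fact.out
  have hodd : Odd p := hpp.odd_of_ne_two (by omega)
  have hpow : p ^ (2 * α) = (p ^ α) ^ 2 := by ring
  refine ⟨fun hn => ?_, fun i hi hi' => ?_, fun j hj => ?_⟩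
  · rw [hpow, show 32 * n + 4 = 4 * (8 * n + 1) by ring]
    refine v0_congr_of_odd hodd.pow (by omega) fun ⟨r, hr⟩ => hn ?_
    obtain ⟨k, rfl⟩ : Odd r := by
      have : Odd (r * r) := hr ▸ ⟨4 * n, by ring⟩
      exact (Nat.odd_mul.1 this).1
    refine ⟨k, ?_⟩
    have : k * (k + 1) = 2 * n := by nlinarith
    omega
  · have hp8 : p * p % 8 = 1 := by
      have := sq_mod_eight_of_odd hodd
      rwa [sq] at this
    rw [show p ^ (2 * α + 1) * 9 ^ 2 * (32 * p * n + 32 * i + 4 * p) =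
      (p ^ α) ^ 2 * 9 ^ 2 * (4 * (p * (8 * (p * n + i) + p))) by ring]
    refine v0_congr_of_odd hodd.pow ?_ fun ⟨r, hr⟩ => ?_
    · rw [show p * (8 * (p * n + i) + p) = p * p + 8 * (p * (p * n + i)) by ring]
      omega
    -- A square divisible by p is divisible by p², which would force p ∣ 8i, impossible for odd p
    -- and 0 < i < p.
    · have h1 : p ∣ r * r := hr ▸ dvd_mul_right _ _
      obtain ⟨s, rfl⟩ : p ∣ r := (hpp.dvd_mul.1 h1).elim id id
      have h2 : 8 * (p * n + i) + p = p * (s * s) :=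
        Nat.eq_of_mul_eq_mul_left hpp.pos (by rw [hr]; ring)
      have h3 : p ∣ 8 * i := by
        have h4 : p ∣ 8 * i + p * (8 * n + 1) := ⟨s * s, by rw [← h2]; ring⟩
        exact (Nat.dvd_add_left (dvd_mul_right _ _)).1 h4
      rcases hpp.dvd_mul.1 h3 with h | h
      · have : p ∣ 2 ^ 3 := h
        have := Nat.le_of_dvd two_pos (hpp.dvd_of_dvd_pow this)
        omega
      · have := Nat.le_of_dvd hi h
        omega
  · rw [hpow, show 32 * p * n + 32 * j + 4 = 4 * (8 * (p * n + j) + 1) by ring]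
    refine v0_congr_of_odd hodd.pow (by omega) fun ⟨r, hr⟩ => ?_
    refine (legendreSym.eq_neg_one_iff p).1 hj ⟨(r : ZMod p), ?_⟩
    have := congrArg (Nat.cast : ℕ → ZMod p) hr
    push_cast at this ⊢
    rw [← this]
    simp
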